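/- For $\nu\in\mathbb{C}$ let $J_\nu(z)=\sum_{m\ge 0}\frac{(-1)^m}{m!\,\Gamma(\nu+m+1)}\left(\frac z2\right)^{2m+\nu}$ denote the Bessel function of the first kind, with the principal branch of the power (with $\arg z=\pi$ for $z<0$, so that $J_\nu(-x)=e^{i\pi\nu}J_\nu(x)$ for $x>0$). Let $\varepsilon_0=\tfrac12$ and $\varepsilon_m=1$ for $m\ge1$. Let $a,b$ be non-zero real numbers with $|a|+|b|\le 2\pi$, let $\mu,\nu\in\mathbb{C}$, neither of them a negative integer, and let $k\in\mathbb{N}_0=\{0,1,2,\dots\}$ with $\mathrm{Re}(\mu+\nu)>2k-1$. If $|a|+|b|=2\pi$ or $a=b$ or $a=-b$, assume moreover that $\mathrm{Re}(\mu+\nu)>2k$. Then $$\int_0^\infty \frac{J_\mu(at)\,J_\nu(bt)}{t^{\mu+\nu-2k}}\,dt=\sum_{m=0}^\infty\varepsilon_m\,\frac{J_\mu(am)\,J_\nu(bm)}{m^{\mu+\nu-2k}}.$$ Here the quotient in the term $m=0$ denotes $\lim_{t\to0^+}J_\mu(at)J_\nu(bt)\,t^{-(\mu+\nu-2k)}$,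 which exists; the integral is the improper integral $\lim_{T\to\infty}\int_0^T$ and the series is the limit of its partial sums, and both converge (possibly only conditionally). -/

import Mathlib

open Filter Topology MeasureTheory

noncomputable section

/-- The Bessel function of the first kind of complex order `ν`,
`J_ν(z) = (z/2)^ν ∑_{m ≥ 0} (-1)^m (z/2)^(2m) / (m! Γ(ν + m + 1))`,
with the principal branch of `(z/2)^ν`; on the negative real axis the argument is `π`, so that
`J_ν(-x) = exp(iπν) J_ν(x)` for `x > 0`. Mathlib sets `Γ` to `0` at its poles and `1 / 0 = 0`, so
that `1 / Γ` has its usual value `0` there. -/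
def besselJ (ν z : ℂ) : ℂ :=
  (z / 2) ^ ν *
    ∑' m : ℕ, (-1 : ℂ) ^ m * (z / 2) ^ (2 * m) /
      ((m.factorial : ℂ) * Complex.Gamma (ν + (m : ℂ) + 1))

/-- `J_μ(a t) J_ν(b t) / t^(μ + ν - 2k)`, meant for `t > 0`. -/
def besselQuotient (μ ν : ℂ) (a b : ℝ) (k : ℕ) (t : ℝ) : ℂ :=
  besselJ μ ((a * t : ℝ) : ℂ) * besselJ ν ((b * t : ℝ) : ℂ) /
    (t : ℂ) ^ (μ + ν - 2 * (k : ℂ))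

/-- The weight `ε_m`: `1/2` for `m = 0` and `1` for `m ≥ 1`. -/
def epsilonWeight (m : ℕ) : ℂ := if m = 0 then 1 / 2 else 1

end

/-! For t > 0 the quotient is a constant times h(t) = t^(2k) E_μ(|a|t) E_ν(|b|t), where E_μ(z) =
(z/2)^(-μ) J_μ(z) is even and entire. So h is even and entire of exponential type |a| + |b| ≤ 2π,
and on the real line it is O(|x|^(-p)) with p = Re(μ+ν) + 1 - 2k > 0. By evenness, the claim is
Poisson summation for h in which only the zero frequency survives.

If p > 1, everything converges absolutely. Phragmén–Lindelöf carries the decay of h into the upper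
half-plane against the growth e^(2π Im z), and a contour shift then shows that the Fourier transform
of h vanishes at every nonzero integer, ±1 included (`upper_half_plane_bound`,
`integral_mul_exp_eq_zero`, `tsum_int_eq_integral`).

If 0 < p ≤ 1, the hypotheses force |a| + |b| < 2π and |a| ≠ |b|. The spare type δ = 2π - |a| - |b|
pays for a smooth cutoff: an entire Φ of type δ that is close to c·sign on the real line
(`exists_entire_sign`). Exact Poisson summation holds for h(z)(Φ(z+N) - Φ(z-N)), and replacing Φ by
c·sign costs errors that vanish as N → ∞. Hence the trapezoidal sum and the integral over [0, N]
have difference tending to 0 (`tendsto_sum_sub_integral`). The integral itself converges because the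
Wronskian of the two Bessel equations with distinct frequencies is almost an antiderivative of h
(`exists_tendsto_integral_of_bessel_ode`).

The decay of E_μ comes from an energy estimate for Bessel's equation (`bounded_of_bessel_ode`), with
no appeal to asymptotic expansions. -/

/-! ### The entire series behind the Bessel functions -/

/-- The coefficients `1 / (m! Γ(μ + m + 1))`. -/
noncomputable def besselCoeff (μ : ℂ) (m : ℕ) : ℂ :=
  ((m.factorial : ℂ) * Complex.Gamma (μ + (m : ℂ) + 1))⁻¹

/-- The Bessel–Clifford function `∑ w ^ m / (m! Γ(μ + m + 1))`. -/
noncomputable def besselClifford (μ w : ℂ) : ℂ := ∑' m : ℕ, besselCoeff μ m * w ^ m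

/-- The even entire function `(z / 2) ^ (-μ) J_μ(z)`. -/
noncomputable def besselEntire (μ z : ℂ) : ℂ := besselClifford μ (-(z / 2) ^ 2)

theorem besselJ_eq (μ z : ℂ) : besselJ μ z = (z / 2) ^ μ * besselEntire μ z := by
  unfold besselJ besselEntire besselClifford besselCoeff
  congr 1
  refine tsum_congr fun m => ?_
  rw [neg_pow ((z / 2) ^ 2), ← pow_mul, div_eq_mul_inv]
  ring

/-- The functional equation of 1/Γ, which holds at the poles too with the convention 1/0 = 0, so no
order μ is exceptional. -/
theorem besselCoeff_succ (μ : ℂ) (m : ℕ) :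
    ((m : ℂ) + 1) * (μ + m + 1) * besselCoeff μ (m + 1) = besselCoeff μ m := by
  have h := Complex.one_div_Gamma_eq_self_mul_one_div_Gamma_add_one (μ + m + 1)
  have hm : (m : ℂ) + 1 ≠ 0 := by exact_mod_cast Nat.succ_ne_zero m
  unfold besselCoeff
  rw [mul_inv, mul_inv, h, Nat.factorial_succ]
  push_cast
  rw [show μ + ((m : ℂ) + 1) + 1 = μ + m + 1 + 1 by ring]
  field_simp

theorem succ_mul_besselCoeff_succ (μ : ℂ) (m : ℕ) :
    ((m : ℂ) + 1) * besselCoeff μ (m + 1) = besselCoeff (μ + 1) m := by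
  have hm : (m : ℂ) + 1 ≠ 0 := by exact_mod_cast Nat.succ_ne_zero m
  unfold besselCoeff
  rw [Nat.factorial_succ]
  push_cast
  rw [show μ + ((m : ℂ) + 1) + 1 = μ + 1 + m + 1 by ring, mul_assoc, mul_inv ((m : ℂ) + 1),
    mul_inv_cancel_left₀ hm]

theorem besselCoeff_eq (μ : ℂ) (m : ℕ) :
    besselCoeff μ m = (μ + m + 1) * besselCoeff (μ + 1) m := by
  rw [← besselCoeff_succ, ← succ_mul_besselCoeff_succ]
  ring

theorem bddAbove_of_eventually_antitone {d : ℕ → ℝ} {N : ℕ} (h : ∀ m ≥ N, d (m + 1) ≤ d m) :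
    ∃ C, ∀ m, d m ≤ C := by
  obtain ⟨C, hC⟩ := ((Finset.range (N + 1)).image d).bddAbove
  have hC' : ∀ m ≤ N, d m ≤ C := fun m hm =>
    hC (Finset.mem_coe.2 (Finset.mem_image_of_mem _ (Finset.mem_range.2 (by omega))))
  refine ⟨C, fun m => ?_⟩
  rcases le_total m N with hm | hm
  · exact hC' m hm
  · induction m, hm using Nat.le_induction with
    | base => exact hC' N le_rfl
    | succ m hm ih => exact (h m hm).trans ih

/-- Compare ratios of consecutive terms: the slack σ > 1 absorbs the shift by μ once m is large.
After multiplication by (|z|/2)^(2m) the majorant becomes the cosh series of σ|z|, which is what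
gives exponential type 1. -/
theorem exists_norm_besselCoeff_le (μ : ℂ) {σ : ℝ} (hσ : 1 < σ) :
    ∃ C, ∀ m : ℕ, ‖besselCoeff μ m‖ ≤ C * ((2 * σ) ^ (2 * m) / (2 * m).factorial) := by
  -- For m beyond this threshold, 2σ²(m + 1 - ‖μ‖) ≥ 2m + 1, so the normalised coefficients
  -- decrease.
  obtain ⟨N, hN⟩ := exists_nat_ge (σ ^ 2 * ‖μ‖ / (σ ^ 2 - 1))
  have hσ2 : 0 < σ ^ 2 - 1 := by nlinarith
  obtain ⟨C, hC⟩ := bddAbove_of_eventually_antitone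
    (d := fun m => ‖besselCoeff μ m‖ * ((2 * m).factorial / (2 * σ) ^ (2 * m))) (N := N) (by
    intro m hm
    have hm' : σ ^ 2 * ‖μ‖ ≤ m * (σ ^ 2 - 1) := by
      rw [← div_le_iff₀ hσ2]; exact hN.trans (by exact_mod_cast hm)
    have h1 : (m : ℝ) + 1 - ‖μ‖ ≤ ‖μ + m + 1‖ := by
      have := norm_sub_norm_le ((m : ℂ) + 1) (-μ)
      rw [norm_neg, show (m : ℂ) + 1 - -μ = μ + m + 1 by ring] at this
      have h2 : ‖(m : ℂ) + 1‖ = m + 1 := by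
        exact_mod_cast Complex.norm_natCast (m + 1)
      linarith
    have h2 : (2 * m + 1 : ℝ) ≤ 2 * σ ^ 2 * ‖μ + m + 1‖ := by nlinarith
    rw [← besselCoeff_succ μ m, norm_mul, norm_mul]
    have h3 : ‖(m : ℂ) + 1‖ = m + 1 := by exact_mod_cast Complex.norm_natCast (m + 1)
    rw [h3, show 2 * (m + 1) = 2 * m + 1 + 1 by ring, Nat.factorial_succ, Nat.factorial_succ]
    push_cast
    rw [show ∀ A B c F P : ℝ, A * B * c * (F / P) = c * (F / P) * (A * B) by intros; ring,
      pow_succ, pow_succ]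
    have h4 : (2 * (m : ℝ) + 1 + 1) * ((2 * m + 1) * ((2 * m).factorial : ℝ)) /
        ((2 * σ) ^ (2 * m) * (2 * σ) * (2 * σ)) =
        ((2 * m).factorial / (2 * σ) ^ (2 * m)) *
          ((m + 1) * ((2 * m + 1) / (2 * σ ^ 2))) := by
      have : σ ≠ 0 := by positivity
      field_simp
      ring
    rw [h4, ← mul_assoc]
    have h5 : (2 * (m : ℝ) + 1) / (2 * σ ^ 2) ≤ ‖μ + m + 1‖ := by
      rw [div_le_iff₀ (by positivity)]; linarith
    gcongr)
  refine ⟨C, fun m => ?_⟩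
  have hp : 0 < (2 * σ) ^ (2 * m) / ((2 * m).factorial : ℝ) := by positivity
  rw [← div_le_iff₀ hp]
  refine (hC m).trans_eq' ?_
  rw [div_div_eq_mul_div, mul_div_assoc]

theorem summable_even_pow_div_factorial (x : ℝ) :
    Summable (fun m : ℕ => x ^ (2 * m) / ((2 * m).factorial : ℝ)) ∧
      ∑' m : ℕ, x ^ (2 * m) / ((2 * m).factorial : ℝ) ≤ Real.exp |x| := by
  have h := Real.hasSum_cosh x
  refine ⟨h.summable, ?_⟩
  rw [h.tsum_eq, ← Real.cosh_abs, Real.cosh_eq]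
  have : Real.exp (-|x|) ≤ Real.exp |x| := Real.exp_le_exp.2 (by linarith [abs_nonneg x])
  linarith

theorem exists_norm_term_le (μ : ℂ) {σ : ℝ} (hσ : 1 < σ) :
    ∃ C, 0 ≤ C ∧ ∀ (z : ℂ) (m : ℕ), ‖besselCoeff μ m * (-(z / 2) ^ 2) ^ m‖ ≤
      C * ((σ * ‖z‖) ^ (2 * m) / (2 * m).factorial) := by
  obtain ⟨C, hC⟩ := exists_norm_besselCoeff_le μ hσ
  have hC0 : 0 ≤ C := by
    have := (norm_nonneg _).trans (hC 0)
    simpa using this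
  refine ⟨C, hC0, fun z m => ?_⟩
  rw [norm_mul, norm_pow, norm_neg, norm_pow, norm_div, ← pow_mul]
  calc ‖besselCoeff μ m‖ * (‖z‖ / ‖(2 : ℂ)‖) ^ (2 * m)
      ≤ C * ((2 * σ) ^ (2 * m) / (2 * m).factorial) * (‖z‖ / ‖(2 : ℂ)‖) ^ (2 * m) := by
        gcongr; exact hC m
    _ = _ := by
        rw [show ‖(2 : ℂ)‖ = 2 by simp, div_pow, mul_pow, mul_pow]
        field_simp

theorem summable_norm_besselCoeff (μ : ℂ) (r : ℝ) :
    Summable fun m : ℕ => ‖besselCoeff μ m‖ * r ^ m := by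
  obtain ⟨C, -, hC⟩ := exists_norm_term_le μ (σ := 2) one_lt_two
  -- The point z = 2√|r| is chosen so that |z/2|² = |r|.
  have hs := ((summable_even_pow_div_factorial (2 * ‖((2 * √|r| : ℝ) : ℂ)‖)).1.mul_left C)
  refine hs.of_norm_bounded fun m => ?_
  refine le_trans (le_of_eq ?_) (hC ((2 * √|r| : ℝ) : ℂ) m)
  rw [norm_mul, norm_mul, norm_norm, norm_pow, norm_pow, norm_neg, norm_pow, norm_div,
    Complex.norm_real, Real.norm_eq_abs, Real.norm_eq_abs,
    abs_of_nonneg (by positivity : (0 : ℝ) ≤ 2 * √|r|)]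
  simp [mul_div_cancel_left₀]

theorem summable_besselClifford (μ w : ℂ) : Summable fun m : ℕ => besselCoeff μ m * w ^ m := by
  refine Summable.of_norm ?_
  simpa only [norm_mul, norm_pow] using summable_norm_besselCoeff μ ‖w‖

theorem hasDerivAt_besselClifford (μ w : ℂ) :
    HasDerivAt (besselClifford μ) (besselClifford (μ + 1) w) w := by
  have hshift : ∀ (y : ℂ) (m : ℕ), besselCoeff μ (m + 1) * (((m + 1 : ℕ) : ℂ) * y ^ m) =
      besselCoeff (μ + 1) m * y ^ m := by
    intro y m
    rw [← succ_mul_besselCoeff_succ]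
    push_cast
    ring
  have hs : Summable fun m : ℕ => ‖besselCoeff μ m‖ * (m * (‖w‖ + 1) ^ (m - 1)) := by
    rw [← summable_nat_add_iff 1]
    refine (summable_norm_besselCoeff (μ + 1) (‖w‖ + 1)).congr fun m => ?_
    rw [← succ_mul_besselCoeff_succ, norm_mul]
    have h3 : ‖(m : ℂ) + 1‖ = m + 1 := by exact_mod_cast Complex.norm_natCast (m + 1)
    rw [h3, Nat.add_sub_cancel]
    push_cast
    ring
  have key := hasDerivAt_tsum_of_isPreconnected (𝕜 := ℂ)
    (g := fun (m : ℕ) w => besselCoeff μ m * w ^ m)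
    (g' := fun (m : ℕ) w => besselCoeff μ m * (m * w ^ (m - 1))) (y := w) (y₀ := w) hs
    (Metric.isOpen_ball (x := (0 : ℂ)) (ε := ‖w‖ + 1)) (convex_ball _ _).isPreconnected
    (fun m y _ => (hasDerivAt_pow m y).const_mul _)
    (fun m y hy => by
      rw [norm_mul, norm_mul, norm_pow, Complex.norm_natCast]
      have : ‖y‖ ≤ ‖w‖ + 1 := (mem_ball_zero_iff.1 hy).le
      gcongr)
    (by simp) (summable_besselClifford μ w) (by simp)
  have heq : ∑' m : ℕ, besselCoeff μ m * (m * w ^ (m - 1)) = besselClifford (μ + 1) w := by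
    rw [tsum_eq_zero_add']
    · simp only [Nat.add_sub_cancel, hshift]
      simp [besselClifford]
    · simp only [Nat.add_sub_cancel, hshift]
      exact summable_besselClifford _ _
  rw [heq] at key
  exact key

/-- The three-term recurrence in the order. Since differentiation raises the order by one, this is
Bessel's differential equation in disguise. -/
theorem besselClifford_eq (μ w : ℂ) :
    besselClifford μ w =
      (μ + 1) * besselClifford (μ + 1) w + w * besselClifford (μ + 1 + 1) w := by
  have h1 : ∀ m : ℕ, besselCoeff μ m * w ^ m = (μ + 1) * (besselCoeff (μ + 1) m * w ^ m) +
      m * (besselCoeff (μ + 1) m * w ^ m) := by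
    intro m; rw [besselCoeff_eq μ m]; ring
  have h2 : ∀ m : ℕ, ((m + 1 : ℕ) : ℂ) * (besselCoeff (μ + 1) (m + 1) * w ^ (m + 1)) =
      w * (besselCoeff (μ + 1 + 1) m * w ^ m) := by
    intro m; rw [← succ_mul_besselCoeff_succ (μ + 1)]; push_cast; ring
  have hs2 : Summable fun m : ℕ => ((m + 1 : ℕ) : ℂ) *
      (besselCoeff (μ + 1) (m + 1) * w ^ (m + 1)) := by
    simp only [h2]
    exact (summable_besselClifford _ _).mul_left _
  have hs : Summable fun m : ℕ => (m : ℂ) * (besselCoeff (μ + 1) m * w ^ m) :=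
    (summable_nat_add_iff 1).1 hs2
  unfold besselClifford
  rw [tsum_congr h1, ((summable_besselClifford _ _).mul_left _).tsum_add hs, tsum_mul_left,
    hs.tsum_eq_zero_add, tsum_congr h2, tsum_mul_left]
  simp

theorem besselEntire_neg (μ z : ℂ) : besselEntire μ (-z) = besselEntire μ z := by
  unfold besselEntire; congr 2; ring

theorem hasDerivAt_besselEntire (μ z : ℂ) :
    HasDerivAt (besselEntire μ) (-(z / 2) * besselEntire (μ + 1) z) z := by
  have h : HasDerivAt (fun z : ℂ => -(z / 2) ^ 2) (-(z / 2)) z := by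
    have := (((hasDerivAt_id z).div_const 2).pow 2).neg
    refine this.congr_deriv ?_
    simp only [id]
    ring
  have := (hasDerivAt_besselClifford μ (-(z / 2) ^ 2)).comp z h
  refine this.congr_deriv ?_
  unfold besselEntire
  ring

theorem besselEntire_eq (μ z : ℂ) :
    besselEntire μ z =
      (μ + 1) * besselEntire (μ + 1) z - (z / 2) ^ 2 * besselEntire (μ + 1 + 1) z := by
  unfold besselEntire
  rw [besselClifford_eq]
  ring

theorem differentiable_besselEntire (μ : ℂ) : Differentiable ℂ (besselEntire μ) :=
  fun z => (hasDerivAt_besselEntire μ z).differentiableAt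

/-! ### Functions of exponential type. -/

/-- `f` has exponential type at most `τ`. -/
def ExpTypeLE (f : ℂ → ℂ) (τ : ℝ) : Prop :=
  ∀ σ > τ, ∃ C, ∀ z, ‖f z‖ ≤ C * Real.exp (σ * ‖z‖)

theorem expTypeLE_besselEntire (μ : ℂ) : ExpTypeLE (besselEntire μ) 1 := by
  intro σ hσ
  obtain ⟨C, hC0, hC⟩ := exists_norm_term_le μ hσ
  refine ⟨C, fun z => ?_⟩
  obtain ⟨hs, hle⟩ := summable_even_pow_div_factorial (σ * ‖z‖)
  have h1 := tsum_of_norm_bounded (hs.mul_left C).hasSum (hC z)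
  rw [tsum_mul_left] at h1
  refine h1.trans (mul_le_mul_of_nonneg_left ?_ hC0)
  rwa [abs_of_nonneg (by positivity : 0 ≤ σ * ‖z‖)] at hle

theorem ExpTypeLE.mono {f : ℂ → ℂ} {τ τ' : ℝ} (h : ExpTypeLE f τ) (hτ : τ ≤ τ') :
    ExpTypeLE f τ' := fun σ hσ => h σ (lt_of_le_of_lt hτ hσ)

theorem ExpTypeLE.mul {f g : ℂ → ℂ} {τ τ' : ℝ} (hf : ExpTypeLE f τ) (hg : ExpTypeLE g τ') :
    ExpTypeLE (fun z => f z * g z) (τ + τ') := by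
  intro σ hσ
  obtain ⟨C, hC⟩ := hf (τ + (σ - (τ + τ')) / 2) (by linarith)
  obtain ⟨D, hD⟩ := hg (τ' + (σ - (τ + τ')) / 2) (by linarith)
  refine ⟨C * D, fun z => ?_⟩
  rw [norm_mul]
  refine (mul_le_mul (hC z) (hD z) (norm_nonneg _) ((norm_nonneg _).trans (hC z))).trans_eq ?_
  rw [mul_mul_mul_comm, ← Real.exp_add]
  congr 2
  ring

theorem ExpTypeLE.comp_ofReal_mul {f : ℂ → ℂ} {τ a : ℝ} (hf : ExpTypeLE f τ) (ha : 0 < a) :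
    ExpTypeLE (fun z => f (a * z)) (a * τ) := by
  intro σ hσ
  obtain ⟨C, hC⟩ := hf (σ / a) (by rw [gt_iff_lt, lt_div_iff₀ ha]; linarith)
  refine ⟨C, fun z => (hC _).trans_eq ?_⟩
  rw [norm_mul, Complex.norm_real, Real.norm_of_nonneg ha.le]
  congr 2
  field_simp

theorem const_nonneg_of_norm_le_exp {f : ℂ → ℂ} {C σ : ℝ} (h : ∀ z, ‖f z‖ ≤ C * Real.exp (σ * ‖z‖)) :
    0 ≤ C := by
  have := (norm_nonneg _).trans (h 0)
  simpa using this

theorem ExpTypeLE.comp_add_const {f : ℂ → ℂ} {τ : ℝ} (hf : ExpTypeLE f τ) (hτ : 0 ≤ τ) (c : ℂ) :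
    ExpTypeLE (fun z => f (z + c)) τ := by
  intro σ hσ
  obtain ⟨C, hC⟩ := hf σ hσ
  have hC0 := const_nonneg_of_norm_le_exp hC
  refine ⟨C * Real.exp (σ * ‖c‖), fun z => (hC _).trans ?_⟩
  rw [mul_assoc, ← Real.exp_add, ← mul_add]
  have hσ0 : 0 ≤ σ := hτ.trans hσ.le
  gcongr
  linarith [norm_add_le z c]

theorem ExpTypeLE.sub {f g : ℂ → ℂ} {τ : ℝ} (hf : ExpTypeLE f τ) (hg : ExpTypeLE g τ) :
    ExpTypeLE (fun z => f z - g z) τ := by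
  intro σ hσ
  obtain ⟨C, hC⟩ := hf σ hσ
  obtain ⟨D, hD⟩ := hg σ hσ
  refine ⟨C + D, fun z => (norm_sub_le _ _).trans ?_⟩
  rw [add_mul]
  exact add_le_add (hC z) (hD z)

theorem expTypeLE_pow (n : ℕ) : ExpTypeLE (fun z => z ^ n) 0 := by
  intro σ hσ
  refine ⟨n.factorial / σ ^ n, fun z => ?_⟩
  have h := Real.pow_div_factorial_le_exp (σ * ‖z‖) (by positivity) n
  rw [div_le_iff₀ (by positivity)] at h
  rw [norm_pow, div_mul_eq_mul_div, le_div_iff₀ (by positivity), ← mul_pow, mul_comm ‖z‖]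
  linarith

/-! ### Poisson summation for functions of exponential type `2π` -/

theorem one_add_rpow_le_exp {r b : ℝ} (hr : 0 ≤ r) (hb : 0 ≤ b) :
    (1 + r) ^ b ≤ Real.exp (b * r) := by
  rw [mul_comm, Real.exp_mul]
  exact Real.rpow_le_rpow (by linarith) (by linarith [Real.add_one_le_exp r]) hb

theorem norm_I_mul_sub {z : ℂ} : ‖-(Complex.I * z) + 1‖ = ‖z + Complex.I‖ := by
  rw [show -(Complex.I * z) + 1 = -Complex.I * (z + Complex.I) by
    rw [mul_add, neg_mul, neg_mul, Complex.I_mul_I]; ring]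
  simp

/-- Phragmén–Lindelöf in the right half-plane, after the rotation z = iw, for (w+1)^b f(iw)
e^(-(τ+ε)w). On the imaginary axis |w+1| ≤ 1+|x|, so the decay hypothesis bounds it by C; along the
positive real axis the extra ε makes it tend to zero. -/
theorem upper_half_plane_bound {f : ℂ → ℂ} {τ b C : ℝ} (hf : Differentiable ℂ f)
    (hτ : 0 ≤ τ) (hb : 0 ≤ b) (hexp : ExpTypeLE f τ)
    (hdec : ∀ x : ℝ, ‖f x‖ * (1 + |x|) ^ b ≤ C) {z : ℂ} (hz : 0 ≤ z.im) :
    ‖f z‖ * ‖z + Complex.I‖ ^ b ≤ C * Real.exp (τ * z.im) := by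
  have key : ∀ ε > 0, ∀ w : ℂ, 0 ≤ w.re →
      ‖w + 1‖ ^ b * ‖f (Complex.I * w)‖ * Real.exp (-(τ + ε) * w.re) ≤ C := by
    intro ε hε
    set G : ℂ → ℂ := fun w =>
      (w + 1) ^ (b : ℂ) * f (Complex.I * w) * Complex.exp (-((τ + ε : ℝ) : ℂ) * w) with hG
    have hGn : ∀ w, ‖G w‖ =
        ‖w + 1‖ ^ b * ‖f (Complex.I * w)‖ * Real.exp (-(τ + ε) * w.re) := by
      intro w
      simp only [hG, norm_mul, Complex.norm_cpow_real, Complex.norm_exp]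
      congr 2
      rw [← Complex.ofReal_neg, Complex.re_ofReal_mul]
    intro w hw
    rw [← hGn]
    -- Only half of ε is spent on the growth of f; the remaining e^(-εx/2) beats the power (1+x)^b
    -- on the real axis.
    obtain ⟨D, hD⟩ := hexp (τ + ε / 2) (by linarith)
    have hD0 := const_nonneg_of_norm_le_exp hD
    refine PhragmenLindelof.right_half_plane_of_tendsto_zero_on_real ?_ ?_ ?_ ?_ hw
    · have hd : ∀ w : ℂ, 0 ≤ w.re → DifferentiableAt ℂ G w := by
        intro w hw
        have h1 : DifferentiableAt ℂ (fun w : ℂ => (w + 1) ^ (b : ℂ)) w := by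
          refine DifferentiableAt.cpow_const (by fun_prop) ?_
          left
          simp only [Complex.add_re, Complex.one_re]
          linarith
        have h2 : DifferentiableAt ℂ (fun w : ℂ => f (Complex.I * w)) w :=
          (hf.comp (differentiable_id.const_mul Complex.I)) w
        exact (h1.mul h2).mul (by fun_prop)
      refine DifferentiableOn.diffContOnCl fun w hw => (hd w ?_).differentiableWithinAt
      have : closure {z : ℂ | 0 < z.re} ⊆ {z | 0 ≤ z.re} :=
        closure_minimal (fun z (hz : 0 < z.re) => hz.le)
          (isClosed_le continuous_const Complex.continuous_re)
      exact this hw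
    · refine ⟨1, one_lt_two, b + (τ + ε / 2), ?_⟩
      refine Asymptotics.IsBigO.of_bound D ?_
      rw [eventually_inf_principal]
      refine Eventually.of_forall fun w hw => ?_
      rw [hGn, Real.norm_of_nonneg (Real.exp_nonneg _), Real.rpow_one, add_mul, Real.exp_add]
      have h1 : ‖w + 1‖ ^ b ≤ Real.exp (b * ‖w‖) := by
        refine le_trans ?_ (one_add_rpow_le_exp (norm_nonneg w) hb)
        refine Real.rpow_le_rpow (norm_nonneg _) ?_ hb
        have := norm_add_le w 1
        rw [norm_one] at this
        linarith
      have h2 := hD (Complex.I * w)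
      rw [norm_mul, Complex.norm_I, one_mul] at h2
      have h3 : Real.exp (-(τ + ε) * w.re) ≤ 1 := by
        rw [Real.exp_le_one_iff]
        have : 0 < w.re := hw
        nlinarith
      calc ‖w + 1‖ ^ b * ‖f (Complex.I * w)‖ * Real.exp (-(τ + ε) * w.re)
          ≤ Real.exp (b * ‖w‖) * (D * Real.exp ((τ + ε / 2) * ‖w‖)) * 1 := by
            gcongr
        _ = _ := by ring
    · rw [tendsto_zero_iff_norm_tendsto_zero]
      have h1 : Tendsto (fun x : ℝ => (1 + x) ^ b * Real.exp (-(ε / 2) * (1 + x))) atTop (𝓝 0) :=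
        (tendsto_rpow_mul_exp_neg_mul_atTop_nhds_zero b (ε / 2) (by positivity)).comp
          (tendsto_atTop_add_const_left _ 1 tendsto_id)
      have h2 := h1.const_mul (D * Real.exp (ε / 2))
      rw [mul_zero] at h2
      refine squeeze_zero' (Eventually.of_forall fun _ => norm_nonneg _) ?_ h2
      filter_upwards [eventually_ge_atTop 0] with x hx
      rw [hGn]
      have h3 : ‖(x : ℂ) + 1‖ = 1 + x := by
        rw [show (x : ℂ) + 1 = ((1 + x : ℝ) : ℂ) by push_cast; ring, Complex.norm_real,
          Real.norm_of_nonneg (by linarith)]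
      have h4 := hD (Complex.I * x)
      rw [norm_mul, Complex.norm_I, one_mul, Complex.norm_real, Real.norm_of_nonneg hx] at h4
      rw [h3, Complex.ofReal_re]
      calc (1 + x) ^ b * ‖f (Complex.I * x)‖ * Real.exp (-(τ + ε) * x)
          ≤ (1 + x) ^ b * (D * Real.exp ((τ + ε / 2) * x)) * Real.exp (-(τ + ε) * x) := by
            gcongr
        _ = (1 + x) ^ b * D * (Real.exp ((τ + ε / 2) * x) * Real.exp (-(τ + ε) * x)) := by ring
        _ = (1 + x) ^ b * D * (Real.exp (ε / 2) * Real.exp (-(ε / 2) * (1 + x))) := by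
            rw [← Real.exp_add, ← Real.exp_add]
            congr 2
            ring
        _ = _ := by ring
    · intro x
      rw [hGn]
      have h1 : Complex.I * (x * Complex.I) = ((-x : ℝ) : ℂ) := by
        push_cast
        linear_combination (x : ℂ) * Complex.I_mul_I
      have h2 : ‖(x : ℂ) * Complex.I + 1‖ ≤ 1 + |x| := by
        refine (norm_add_le _ _).trans_eq ?_
        simp [add_comm]
      rw [h1]
      have h3 := hdec (-x)
      rw [abs_neg] at h3
      simp only [Complex.mul_re, Complex.ofReal_re, Complex.I_re, mul_zero, Complex.ofReal_im,
        zero_mul, sub_zero, Real.exp_zero, mul_one]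
      refine le_trans ?_ h3
      rw [mul_comm]
      gcongr
  have h := fun ε hε => key ε hε (-(Complex.I * z)) (by simpa using hz)
  have hre : (-(Complex.I * z)).re = z.im := by simp
  have hIz : Complex.I * -(Complex.I * z) = z := by
    linear_combination -z * Complex.I_mul_I
  rw [hre, hIz, norm_I_mul_sub] at h
  -- The bound C does not depend on ε, so ε can tend to 0.
  have hlim : Tendsto (fun ε : ℝ => ‖z + Complex.I‖ ^ b * ‖f z‖ * Real.exp (-(τ + ε) * z.im))
      (𝓝[>] 0) (𝓝 (‖z + Complex.I‖ ^ b * ‖f z‖ * Real.exp (-(τ + 0) * z.im))) := by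
    refine Tendsto.mono_left (Continuous.tendsto ?_ 0) nhdsWithin_le_nhds
    fun_prop
  have hle := le_of_tendsto hlim (eventually_mem_nhdsWithin.mono fun ε hε => h ε hε)
  rw [add_zero, neg_mul, Real.exp_neg, ← div_eq_mul_inv, div_le_iff₀ (Real.exp_pos _)] at hle
  linarith

theorem integrable_of_decay {f : ℝ → ℂ} {b C : ℝ} (hc : Continuous f) (hb : 1 < b)
    (hdec : ∀ x : ℝ, ‖f x‖ * (1 + |x|) ^ b ≤ C) : Integrable f := by
  have h := (integrable_one_add_norm (E := ℝ) (μ := volume) (r := b) (by simpa using hb)).const_mul C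
  refine h.mono' hc.aestronglyMeasurable (Eventually.of_forall fun x => ?_)
  rw [Real.rpow_neg (by positivity), ← div_eq_mul_inv, le_div_iff₀ (by positivity)]
  exact hdec x

/-- The Paley–Wiener half of the argument: for m ≥ 1 the factor e^(-2πm Im z) cancels the growth of
f in the upper half-plane. At m = 1 nothing is left over, and the power decay with b > 1 alone
closes the contour. -/
theorem integral_mul_exp_eq_zero {f : ℂ → ℂ} {b C m : ℝ} (hf : Differentiable ℂ f)
    (hb : 1 < b) (hexp : ExpTypeLE f (2 * Real.pi))
    (hdec : ∀ x : ℝ, ‖f x‖ * (1 + |x|) ^ b ≤ C) (hm : 1 ≤ m) :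
    ∫ x : ℝ, f x * Complex.exp ((2 * Real.pi * m : ℝ) * Complex.I * x) = 0 := by
  set F : ℂ → ℂ := fun z => f z * Complex.exp ((2 * Real.pi * m : ℝ) * Complex.I * z) with hF
  have hFd : Differentiable ℂ F := hf.mul (by fun_prop)
  have hEn : ∀ z : ℂ, ‖Complex.exp ((2 * Real.pi * m : ℝ) * Complex.I * z)‖ =
      Real.exp (-(2 * Real.pi * m * z.im)) := by
    intro z
    rw [Complex.norm_exp]
    congr 1
    rw [mul_assoc, Complex.re_ofReal_mul]
    simp
  have hC0 : 0 ≤ C := le_trans (by positivity) (hdec 0)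
  have hb0 : 0 ≤ b := by linarith
  have hbound : ∀ R > 0, ∀ z : ℂ, 0 ≤ z.im → R ≤ ‖z + Complex.I‖ → ‖F z‖ ≤ C * R ^ (-b) := by
    intro R hR z hz hRz
    have h1 := upper_half_plane_bound hf (by positivity) hb0 hexp hdec hz
    have h2 : ‖f z‖ * R ^ b ≤ C * Real.exp (2 * Real.pi * z.im) := by
      refine le_trans ?_ h1
      gcongr
    rw [Real.rpow_neg hR.le, ← div_eq_mul_inv, le_div_iff₀ (by positivity)]
    calc ‖F z‖ * R ^ b = ‖f z‖ * R ^ b * Real.exp (-(2 * Real.pi * m * z.im)) := by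
          rw [hF, norm_mul, hEn]; ring
      _ ≤ C * Real.exp (2 * Real.pi * z.im) * Real.exp (-(2 * Real.pi * m * z.im)) := by gcongr
      _ = C * Real.exp (-(2 * Real.pi * z.im * (m - 1))) := by
          rw [mul_assoc, ← Real.exp_add]; congr 2; ring
      _ ≤ C * 1 := by
          gcongr
          rw [Real.exp_le_one_iff, Left.neg_nonpos_iff]
          have : 0 ≤ m - 1 := by linarith
          have := Real.pi_pos
          positivity
      _ = C := mul_one C
  have hint : Integrable (fun x : ℝ => F x) := by
    refine integrable_of_decay (C := C) (hFd.continuous.comp Complex.continuous_ofReal) hb fun x => ?_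
    rw [hF, norm_mul, hEn]
    simpa using hdec x
  have hlim := intervalIntegral_tendsto_integral hint tendsto_neg_atTop_atBot tendsto_id
  refine tendsto_nhds_unique hlim ?_
  have h0 : Tendsto (fun R : ℝ => 4 * C * R ^ (1 - b)) atTop (𝓝 0) := by
    have := (tendsto_rpow_neg_atTop (y := b - 1) (by linarith)).const_mul (4 * C)
    simpa using this
  refine squeeze_zero_norm' ?_ h0
  filter_upwards [eventually_gt_atTop 0] with R hR
  -- Rectangle with opposite corners -R and R + iR. On the other three sides the integrand is
  -- O(R^(-b)) over length O(R), hence a contribution O(R^(1-b)).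
  have hrect := Complex.integral_boundary_rect_eq_zero_of_differentiableOn F
    (((-R : ℝ) : ℂ)) ((R : ℂ) + R * Complex.I) hFd.differentiableOn
  simp only [Complex.ofReal_re, Complex.ofReal_im, Complex.add_re, Complex.mul_re, Complex.I_re,
    mul_zero, Complex.I_im, mul_one, sub_self, add_zero, Complex.add_im, Complex.mul_im, zero_add,
    Complex.ofReal_zero, zero_mul, smul_eq_mul] at hrect
  have hRb : C * R ^ (-b) * R = C * R ^ (1 - b) := by
    rw [mul_assoc, sub_eq_neg_add, Real.rpow_add_one hR.ne']
  have htop : ‖∫ x in (-R)..R, F (x + R * Complex.I)‖ ≤ 2 * (C * R ^ (1 - b)) := by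
    refine (intervalIntegral.norm_integral_le_of_norm_le_const (C := C * R ^ (-b)) ?_).trans_eq ?_
    · intro x _
      refine hbound R hR _ (by simpa using hR.le) ?_
      refine le_trans ?_ (Complex.abs_im_le_norm _)
      simp only [Complex.add_im, Complex.ofReal_im, Complex.mul_im, Complex.ofReal_re,
        Complex.I_im, mul_one, Complex.I_re, mul_zero, add_zero, zero_add]
      rw [abs_of_nonneg (by linarith)]
      linarith
    · rw [sub_neg_eq_add, abs_of_nonneg (by linarith), ← hRb]; ring
  have hside : ∀ s : ℝ, |s| = R →
      ‖Complex.I * ∫ y in (0 : ℝ)..R, F (s + y * Complex.I)‖ ≤ C * R ^ (1 - b) := by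
    intro s hs
    rw [norm_mul, Complex.norm_I, one_mul]
    refine (intervalIntegral.norm_integral_le_of_norm_le_const (C := C * R ^ (-b)) ?_).trans_eq ?_
    · intro y hy
      rw [Set.uIoc_of_le hR.le] at hy
      refine hbound R hR _ (by simpa using hy.1.le) ?_
      refine le_trans ?_ (Complex.abs_re_le_norm _)
      simp [hs]
    · rw [sub_zero, abs_of_nonneg hR.le, hRb]
  have h1 := hside R (abs_of_pos hR)
  have h2 := hside (-R) (by rw [abs_neg, abs_of_pos hR])
  have heq : ∫ x in (-R)..R, F x = (∫ x in (-R)..R, F (x + R * Complex.I)) -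
      (Complex.I * ∫ y in (0 : ℝ)..R, F (R + y * Complex.I)) +
      Complex.I * ∫ y in (0 : ℝ)..R, F (((-R : ℝ) : ℂ) + y * Complex.I) := by
    linear_combination hrect
  simp only [id]
  rw [heq]
  refine (norm_add_le _ _).trans ?_
  have := norm_sub_le (∫ x in (-R)..R, F (x + R * Complex.I))
      (Complex.I * ∫ y in (0 : ℝ)..R, F (R + y * Complex.I))
  linarith

theorem summable_int_of_decay {f : ℝ → ℂ} {b C : ℝ} (hb : 1 < b)
    (hdec : ∀ x : ℝ, ‖f x‖ * (1 + |x|) ^ b ≤ C) : Summable fun n : ℤ => f n := by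
  have hC0 : 0 ≤ C := le_trans (by positivity) (hdec 0)
  refine (((Real.summable_abs_int_rpow hb).mul_left C).of_norm_bounded_eventually ?_)
  have : ∀ᶠ n : ℤ in cofinite, n ≠ 0 := (Set.finite_singleton 0).eventually_cofinite_notMem
  filter_upwards [this] with n hn
  have hn' : 0 < |(n : ℝ)| := by positivity
  rw [Real.rpow_neg hn'.le, ← div_eq_mul_inv, le_div_iff₀ (by positivity)]
  refine le_trans ?_ (hdec n)
  gcongr
  linarith

open FourierTransform in
-- Poisson summation in which every nonzero frequency drops out. Negative n fall directly under the
-- upper half-plane lemma; positive n do so after replacing f(z) by f(-z).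
theorem tsum_int_eq_integral {f : ℂ → ℂ} {b C : ℝ} (hf : Differentiable ℂ f)
    (hb : 1 < b) (hexp : ExpTypeLE f (2 * Real.pi))
    (hdec : ∀ x : ℝ, ‖f x‖ * (1 + |x|) ^ b ≤ C) :
    ∑' n : ℤ, f n = ∫ x : ℝ, f x := by
  have hC0 : 0 ≤ C := le_trans (by positivity) (hdec 0)
  have hFour : ∀ n : ℤ, 𝓕 (fun x : ℝ => f x) (n : ℝ) =
      ∫ x : ℝ, f x * Complex.exp ((-2 * Real.pi * n : ℝ) * Complex.I * x) := by
    intro n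
    rw [Real.fourier_real_eq_integral_exp_smul]
    refine integral_congr_ae (Eventually.of_forall fun x => ?_)
    simp only [smul_eq_mul]
    rw [mul_comm]
    congr 2
    push_cast
    ring
  have hzero : ∀ n : ℤ, n ≠ 0 → 𝓕 (fun x : ℝ => f x) (n : ℝ) = 0 := by
    intro n hn
    rw [hFour]
    rcases lt_or_gt_of_ne hn with h | h
    · have h1 : (1 : ℝ) ≤ -(n : ℝ) := by exact_mod_cast (by omega : (1 : ℤ) ≤ -n)
      rw [← integral_mul_exp_eq_zero hf hb hexp hdec h1]
      refine integral_congr_ae (Eventually.of_forall fun x => ?_)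
      dsimp only
      congr 4
      ring_nf
    · have h1 : (1 : ℝ) ≤ (n : ℝ) := by exact_mod_cast (by omega : (1 : ℤ) ≤ n)
      have hexp' : ExpTypeLE (fun z => f (-z)) (2 * Real.pi) := by
        intro σ hσ
        obtain ⟨D, hD⟩ := hexp σ hσ
        exact ⟨D, fun z => by simpa using hD (-z)⟩
      rw [← integral_mul_exp_eq_zero (f := fun z => f (-z)) (hf.comp differentiable_neg) hb hexp'
        (C := C) (fun x => by simpa using hdec (-x)) h1, ← integral_neg_eq_self]
      refine integral_congr_ae (Eventually.of_forall fun x => ?_)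
      dsimp only
      push_cast
      congr 2
      ring
  have hP := Real.tsum_eq_tsum_fourier_of_rpow_decay_of_summable (f := fun x : ℝ => f x)
    (hf.continuous.comp Complex.continuous_ofReal) hb ?_ ?_ 0
  · simp only [zero_add, QuotientAddGroup.mk_zero, fourier_eval_zero, mul_one] at hP
    rw [tsum_eq_single 0 hzero, hFour] at hP
    simpa using hP
  · refine Asymptotics.IsBigO.of_bound C ?_
    filter_upwards [(isCompact_singleton (x := (0 : ℝ))).compl_mem_cocompact] with x hx
    have hx' : 0 < |x| := abs_pos.2 hx
    rw [Real.norm_of_nonneg (by positivity), Real.rpow_neg hx'.le, ← div_eq_mul_inv,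
      le_div_iff₀ (by positivity)]
    refine le_trans ?_ (hdec x)
    gcongr
    linarith
  · exact summable_of_ne_finset_zero (s := {0}) fun n hn => hzero n (by simpa using hn)

/-! ### Bounds and oscillation of the Bessel functions on the positive half-line -/

/-- Energy estimate for U'' = -(α² + q/t²)U. The energy α²|U|² + |V|² is conserved when q = 0, and
in general its derivative is at most c/t² times itself with c = |q|/α. Since 1/t² is integrable at
infinity, the integrating factor e^(c/t) makes it nonincreasing. -/
theorem bounded_of_bessel_ode {U V : ℝ → ℂ} {α : ℝ} {q : ℂ} (hα : 0 < α)
    (hU : ∀ t : ℝ, 1 ≤ t → HasDerivAt U (V t) t)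
    (hV : ∀ t : ℝ, 1 ≤ t → HasDerivAt V (-((α : ℂ) ^ 2 + q / (t : ℂ) ^ 2) * U t) t) :
    ∃ C, ∀ t ≥ 1, ‖U t‖ ≤ C ∧ ‖V t‖ ≤ C := by
  set c := ‖q‖ / α with hc
  have hc0 : 0 ≤ c := by positivity
  set E : ℝ → ℝ := fun t => α ^ 2 * ‖U t‖ ^ 2 + ‖V t‖ ^ 2 with hE
  have hE0 : ∀ t, 0 ≤ E t := fun t => by positivity
  have hEd : ∀ t ≥ 1, HasDerivAt E (-2 * inner ℝ (V t) (q / (t : ℂ) ^ 2 * U t)) t := by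
    intro t ht
    refine (((hU t ht).norm_sq.const_mul (α ^ 2)).add (hV t ht).norm_sq).congr_deriv ?_
    rw [show -((α : ℂ) ^ 2 + q / (t : ℂ) ^ 2) * U t =
      (-(α ^ 2) : ℝ) • U t - q / (t : ℂ) ^ 2 * U t by
        rw [Complex.real_smul]; push_cast; ring]
    rw [inner_sub_right, real_inner_smul_right, real_inner_comm (U t) (V t)]
    ring
  have hEle : ∀ t ≥ 1, -2 * inner ℝ (V t) (q / (t : ℂ) ^ 2 * U t) ≤ c / t ^ 2 * E t := by
    intro t ht
    have h1 := abs_real_inner_le_norm (V t) (q / (t : ℂ) ^ 2 * U t)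
    have h2 : ‖q / (t : ℂ) ^ 2 * U t‖ = ‖q‖ / t ^ 2 * ‖U t‖ := by
      rw [norm_mul, norm_div, norm_pow, Complex.norm_real, Real.norm_of_nonneg (by linarith)]
    rw [h2] at h1
    have h3 : -2 * inner ℝ (V t) (q / (t : ℂ) ^ 2 * U t) ≤
        2 * (‖V t‖ * (‖q‖ / t ^ 2 * ‖U t‖)) := by
      have := (abs_le.1 h1).1
      linarith
    refine h3.trans ?_
    have h4 : 2 * (α * ‖U t‖) * ‖V t‖ ≤ E t := by
      have := two_mul_le_add_sq (α * ‖U t‖) ‖V t‖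
      rw [mul_pow] at this
      exact this
    calc 2 * (‖V t‖ * (‖q‖ / t ^ 2 * ‖U t‖)) = c / t ^ 2 * (2 * (α * ‖U t‖) * ‖V t‖) := by
          rw [hc]; field_simp
      _ ≤ _ := by gcongr
  set K : ℝ → ℝ := fun t => E t * Real.exp (c / t) with hK
  have hKd : ∀ t ≥ 1, HasDerivAt K ((-2 * inner ℝ (V t) (q / (t : ℂ) ^ 2 * U t) -
      c / t ^ 2 * E t) * Real.exp (c / t)) t := by
    intro t ht
    have ht0 : t ≠ 0 := by linarith
    have h1 : HasDerivAt (fun t : ℝ => c / t) (-(c / t ^ 2)) t := by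
      have := (hasDerivAt_inv ht0).const_mul c
      simp only [div_eq_mul_inv]
      exact this.congr_deriv (by ring)
    exact ((hEd t ht).mul h1.exp).congr_deriv (by ring)
  have hanti : AntitoneOn K (Set.Ici 1) := by
    refine antitoneOn_of_deriv_nonpos (convex_Ici 1)
      (fun t ht => (hKd t ht).continuousAt.continuousWithinAt)
      (fun t ht => (hKd t (interior_subset ht)).differentiableAt.differentiableWithinAt)
      fun t ht => ?_
    have ht' : 1 ≤ t := interior_subset ht
    rw [(hKd t ht').deriv]
    exact mul_nonpos_of_nonpos_of_nonneg (by linarith [hEle t ht']) (Real.exp_nonneg _)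
  have hEb : ∀ t ≥ 1, E t ≤ K 1 := by
    intro t ht
    refine le_trans ?_ (hanti (Set.mem_Ici.2 le_rfl) ht ht)
    refine le_mul_of_one_le_right (hE0 t) (Real.one_le_exp ?_)
    have : 0 < t := by linarith
    positivity
  refine ⟨√(K 1) / α + √(K 1), fun t ht => ⟨?_, ?_⟩⟩
  · have h1 : α * ‖U t‖ ≤ √(K 1) := by
      refine Real.le_sqrt_of_sq_le ?_
      rw [mul_pow]
      have := hEb t ht
      have : 0 ≤ ‖V t‖ ^ 2 := by positivity
      simp only [hE] at *
      linarith
    have h2 : ‖U t‖ ≤ √(K 1) / α := by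
      rw [le_div_iff₀ hα]; linarith
    linarith [Real.sqrt_nonneg (K 1)]
  · have h1 : ‖V t‖ ≤ √(K 1) := by
      refine Real.le_sqrt_of_sq_le ?_
      have := hEb t ht
      have : 0 ≤ α ^ 2 * ‖U t‖ ^ 2 := by positivity
      simp only [hE] at *
      linarith
    have : 0 ≤ √(K 1) / α := by positivity
    linarith

/-! ### The normal form of Bessel's equation. -/

/-- `√t J_μ(α t)` up to a constant factor. -/
noncomputable def besselWave (μ : ℂ) (α t : ℝ) : ℂ :=
  (t : ℂ) ^ (μ + 1 / 2) * besselEntire μ (α * t)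

/-- The derivative of `besselWave`. -/
noncomputable def besselWaveDeriv (μ : ℂ) (α t : ℝ) : ℂ :=
  (t : ℂ) ^ (μ + 1 / 2) * ((μ + 1 / 2) / t * besselEntire μ (α * t) -
    α ^ 2 * t / 2 * besselEntire (μ + 1) (α * t))

theorem hasDerivAt_cpow_ofReal (c : ℂ) {t : ℝ} (ht : 0 < t) :
    HasDerivAt (fun t : ℝ => (t : ℂ) ^ c) (c / t * (t : ℂ) ^ c) t := by
  have ht' : (t : ℂ) ≠ 0 := by exact_mod_cast ht.ne'
  have h := ((hasDerivAt_id (t : ℂ)).cpow_const (c := c)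
    (Complex.ofReal_mem_slitPlane.2 ht)).comp_ofReal
  refine h.congr_deriv ?_
  simp only [id]
  rw [Complex.cpow_sub _ _ ht', Complex.cpow_one]
  ring

theorem hasDerivAt_besselEntire_ofReal (μ : ℂ) (α t : ℝ) :
    HasDerivAt (fun t : ℝ => besselEntire μ (α * t))
      (-(α ^ 2 * t / 2) * besselEntire (μ + 1) (α * t)) t := by
  have h := ((hasDerivAt_besselEntire μ (α * t)).comp (t : ℂ)
    ((hasDerivAt_id (t : ℂ)).const_mul (α : ℂ))).comp_ofReal
  refine h.congr_deriv ?_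
  ring

theorem hasDerivAt_besselWave (μ : ℂ) (α : ℝ) {t : ℝ} (ht : 0 < t) :
    HasDerivAt (besselWave μ α) (besselWaveDeriv μ α t) t := by
  refine ((hasDerivAt_cpow_ofReal (μ + 1 / 2) ht).mul
    (hasDerivAt_besselEntire_ofReal μ α t)).congr_deriv ?_
  unfold besselWaveDeriv
  ring

/-- The factor t^(1/2) removes the first-order term of Bessel's equation; what remains is the
recurrence `besselEntire_eq`. -/
theorem hasDerivAt_besselWaveDeriv (μ : ℂ) (α : ℝ) {t : ℝ} (ht : 0 < t) :
    HasDerivAt (besselWaveDeriv μ α)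
      (-((α : ℂ) ^ 2 + (1 / 4 - μ ^ 2) / (t : ℂ) ^ 2) * besselWave μ α t) t := by
  have ht' : (t : ℂ) ≠ 0 := by exact_mod_cast ht.ne'
  have h1 : HasDerivAt (fun t : ℝ => (μ + 1 / 2) / (t : ℂ)) (-((μ + 1 / 2) / (t : ℂ) ^ 2)) t := by
    have := ((hasDerivAt_inv ht').const_mul (μ + 1 / 2)).comp_ofReal
    simp only [div_eq_mul_inv] at this ⊢
    exact this.congr_deriv (by ring)
  have h2 : HasDerivAt (fun t : ℝ => (α : ℂ) ^ 2 * t / 2) ((α : ℂ) ^ 2 / 2) t := by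
    have := (((hasDerivAt_id (t : ℂ)).const_mul ((α : ℂ) ^ 2)).div_const 2).comp_ofReal
    exact this.congr_deriv (by ring)
  refine ((hasDerivAt_cpow_ofReal (μ + 1 / 2) ht).mul
    ((h1.mul (hasDerivAt_besselEntire_ofReal μ α t)).sub
      (h2.mul (hasDerivAt_besselEntire_ofReal (μ + 1) α t)))).congr_deriv ?_
  unfold besselWave
  simp only [Pi.mul_apply, Pi.sub_apply]
  rw [besselEntire_eq μ (α * t)]
  field_simp
  ring

theorem exists_besselWave_bound (μ : ℂ) {α : ℝ} (hα : 0 < α) :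
    ∃ C, ∀ t ≥ 1, ‖besselWave μ α t‖ ≤ C ∧ ‖besselWaveDeriv μ α t‖ ≤ C :=
  bounded_of_bessel_ode hα (fun _ ht => hasDerivAt_besselWave μ α (by linarith))
    (fun _ ht => hasDerivAt_besselWaveDeriv μ α (by linarith))

theorem norm_cpow_ofReal_of_one_le (s : ℂ) {t : ℝ} (ht : 1 ≤ t) :
    ‖(t : ℂ) ^ s‖ = t ^ s.re :=
  Complex.norm_cpow_eq_rpow_re_of_pos (by linarith) s

/-- Products of solutions of Bessel-type equations with different frequencies have convergent
improper integrals against a decaying power. -/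
theorem exists_tendsto_integral_of_bessel_ode {U₁ V₁ U₂ V₂ : ℝ → ℂ} {α β : ℝ} {q₁ q₂ s : ℂ}
    (hα : 0 < α) (hβ : 0 < β) (hαβ : α ≠ β) (hs : 0 < s.re)
    (hU₁ : ∀ t : ℝ, 1 ≤ t → HasDerivAt U₁ (V₁ t) t)
    (hV₁ : ∀ t : ℝ, 1 ≤ t → HasDerivAt V₁ (-((α : ℂ) ^ 2 + q₁ / (t : ℂ) ^ 2) * U₁ t) t)
    (hU₂ : ∀ t : ℝ, 1 ≤ t → HasDerivAt U₂ (V₂ t) t)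
    (hV₂ : ∀ t : ℝ, 1 ≤ t → HasDerivAt V₂ (-((β : ℂ) ^ 2 + q₂ / (t : ℂ) ^ 2) * U₂ t) t) :
    ∃ L, Tendsto (fun T : ℝ => ∫ t in (1 : ℝ)..T, (t : ℂ) ^ (-s) * (U₁ t * U₂ t)) atTop (𝓝 L) := by
  obtain ⟨C, hC⟩ := bounded_of_bessel_ode hα hU₁ hV₁
  obtain ⟨D, hD⟩ := bounded_of_bessel_ode hβ hU₂ hV₂
  have hC0 : 0 ≤ C := (norm_nonneg _).trans (hC 1 le_rfl).1
  have hD0 : 0 ≤ D := (norm_nonneg _).trans (hD 1 le_rfl).1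
  -- The Wronskian: W' = (α² - β² + (q₁ - q₂)/t²) U₁U₂. Thus t^(-s) W is an antiderivative of (α² -
  -- β²) times the integrand, up to the remainder R = O(t^(-Re s - 1)), which is absolutely
  -- integrable.
  set W : ℝ → ℂ := fun t => U₁ t * V₂ t - V₁ t * U₂ t with hW
  have hWb : ∀ t ≥ 1, ‖W t‖ ≤ 2 * (C * D) := by
    intro t ht
    refine (norm_sub_le _ _).trans ?_
    rw [norm_mul, norm_mul, two_mul]
    have h1 := hC t ht
    have h2 := hD t ht
    gcongr
    exacts [h1.1, h2.2, h1.2, h2.1]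
  set R : ℝ → ℂ := fun t => (t : ℂ) ^ (-s) *
    (s / t * W t - (q₁ - q₂) / (t : ℂ) ^ 2 * (U₁ t * U₂ t)) with hR
  set Q : ℝ → ℂ := fun t => (t : ℂ) ^ (-s) * (U₁ t * U₂ t) with hQ
  set P : ℝ → ℂ := fun t => (t : ℂ) ^ (-s) * W t with hP
  have hPd : ∀ t ≥ 1, HasDerivAt P (((α : ℂ) ^ 2 - (β : ℂ) ^ 2) * Q t - R t) t := by
    intro t ht
    refine ((hasDerivAt_cpow_ofReal (-s) (by linarith)).mul
      (((hU₁ t ht).mul (hV₂ t ht)).sub ((hV₁ t ht).mul (hU₂ t ht)))).congr_deriv ?_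
    simp only [hQ, hR, hW, Pi.mul_apply, Pi.sub_apply]
    ring
  have hpc : ContinuousOn (fun t : ℝ => (t : ℂ) ^ (-s)) (Set.Ici 1) := fun t ht =>
    (hasDerivAt_cpow_ofReal (-s) (lt_of_lt_of_le one_pos ht)).continuousAt.continuousWithinAt
  have hU₁c : ContinuousOn U₁ (Set.Ici 1) := fun t ht =>
    (hU₁ t ht).continuousAt.continuousWithinAt
  have hU₂c : ContinuousOn U₂ (Set.Ici 1) := fun t ht =>
    (hU₂ t ht).continuousAt.continuousWithinAt
  have hV₁c : ContinuousOn V₁ (Set.Ici 1) := fun t ht =>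
    (hV₁ t ht).continuousAt.continuousWithinAt
  have hV₂c : ContinuousOn V₂ (Set.Ici 1) := fun t ht =>
    (hV₂ t ht).continuousAt.continuousWithinAt
  have hQc : ContinuousOn Q (Set.Ici 1) := hpc.mul (hU₁c.mul hU₂c)
  have hne : ∀ t ∈ Set.Ici (1 : ℝ), (t : ℂ) ≠ 0 := fun t ht => by
    exact_mod_cast (lt_of_lt_of_le one_pos ht).ne'
  have hRc : ContinuousOn R (Set.Ici 1) := by
    refine hpc.mul (ContinuousOn.sub (ContinuousOn.mul ?_ ((hU₁c.mul hV₂c).sub (hV₁c.mul hU₂c)))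
      (ContinuousOn.mul ?_ (hU₁c.mul hU₂c)))
    · exact continuousOn_const.div Complex.continuous_ofReal.continuousOn hne
    · exact continuousOn_const.div (Complex.continuous_ofReal.pow 2).continuousOn
        fun t ht => pow_ne_zero 2 (hne t ht)
  have hRint : IntegrableOn R (Set.Ioi 1) := by
    have h1 : IntegrableOn (fun t : ℝ => (‖s‖ * (2 * (C * D)) + ‖q₁ - q₂‖ * (C * D)) *
        t ^ (-s.re - 1)) (Set.Ioi 1) :=
      (integrableOn_Ioi_rpow_of_lt (by linarith) one_pos).const_mul _
    refine h1.mono' ((hRc.mono Set.Ioi_subset_Ici_self).aestronglyMeasurable measurableSet_Ioi) ?_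
    refine (ae_restrict_iff' measurableSet_Ioi).2 (Eventually.of_forall fun t ht => ?_)
    have ht1 : 1 ≤ t := le_of_lt ht
    have ht0 : 0 < t := by linarith
    have hsq : ‖(t : ℂ)‖ = t := by rw [Complex.norm_real, Real.norm_of_nonneg ht0.le]
    rw [hR, norm_mul, norm_cpow_ofReal_of_one_le _ ht1, Complex.neg_re, Real.rpow_sub_one ht0.ne',
      mul_div_left_comm]
    refine mul_le_mul_of_nonneg_left ?_ (by positivity)
    refine (norm_sub_le _ _).trans ?_
    rw [norm_mul, norm_mul, norm_div, norm_div, norm_mul, norm_pow, hsq, add_div]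
    have h1 := hC t ht1
    have h2 := hD t ht1
    have hUU : ‖U₁ t‖ * ‖U₂ t‖ ≤ C * D := mul_le_mul h1.1 h2.1 (norm_nonneg _) hC0
    refine add_le_add ?_ ?_
    · rw [div_mul_eq_mul_div]
      gcongr
      exact hWb t ht1
    · rw [div_mul_eq_mul_div]
      gcongr
      nlinarith
  have hPlim : Tendsto P atTop (𝓝 0) := by
    have h0 : Tendsto (fun t : ℝ => t ^ (-s.re) * (2 * (C * D))) atTop (𝓝 0) := by
      have := (tendsto_rpow_neg_atTop hs).mul_const (2 * (C * D))
      simpa using this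
    refine squeeze_zero_norm' ?_ h0
    filter_upwards [eventually_ge_atTop 1] with t ht
    rw [hP, norm_mul, norm_cpow_ofReal_of_one_le _ ht, Complex.neg_re]
    gcongr
    exact hWb t ht
  have hne' : (α : ℂ) ^ 2 - (β : ℂ) ^ 2 ≠ 0 := by
    rw [sub_ne_zero]
    norm_cast
    intro h
    exact hαβ ((pow_left_inj₀ hα.le hβ.le two_ne_zero).1 h)
  refine ⟨((α : ℂ) ^ 2 - (β : ℂ) ^ 2)⁻¹ * (0 - P 1 + ∫ t in Set.Ioi 1, R t), ?_⟩
  have hRlim := intervalIntegral_tendsto_integral_Ioi 1 hRint tendsto_id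
  refine (((hPlim.sub_const (P 1)).add hRlim).const_mul _).congr' ?_
  filter_upwards [eventually_ge_atTop 1] with T hT
  have hsub : Set.uIcc 1 T ⊆ Set.Ici 1 := by
    rw [Set.uIcc_of_le hT]; exact Set.Icc_subset_Ici_self
  have hQi : IntervalIntegrable Q volume 1 T := (hQc.mono hsub).intervalIntegrable
  have hRi : IntervalIntegrable R volume 1 T := (hRc.mono hsub).intervalIntegrable
  have := intervalIntegral.integral_eq_sub_of_hasDerivAt (fun t ht => hPd t (hsub ht))
    ((hQi.const_mul _).sub hRi)
  rw [intervalIntegral.integral_sub (hQi.const_mul _) hRi, intervalIntegral.integral_const_mul]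
    at this
  rw [inv_mul_eq_iff_eq_mul₀ hne', ← this]
  simp only [id]
  ring

/-! ### An entire approximation of the sign function -/

theorem decay_of_even {f : ℝ → ℂ} {b B C : ℝ} (hb : 0 ≤ b) (hf : ∀ x, ‖f (-x)‖ = ‖f x‖)
    (hB : ∀ x ∈ Set.Icc (0 : ℝ) 1, ‖f x‖ ≤ B) (hC : ∀ x : ℝ, 1 ≤ x → ‖f x‖ ≤ C * x ^ (-b)) :
    ∃ D, ∀ x : ℝ, ‖f x‖ * (1 + |x|) ^ b ≤ D := by
  have hB0 : 0 ≤ B := (norm_nonneg _).trans (hB 0 ⟨le_rfl, zero_le_one⟩)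
  have hC0 : 0 ≤ C := by
    have := (norm_nonneg _).trans (hC 1 le_rfl)
    simpa using this
  have key : ∀ x : ℝ, 0 ≤ x → ‖f x‖ * (1 + x) ^ b ≤ (B + C) * 2 ^ b := by
    intro x hx
    rcases le_total x 1 with h | h
    · have h1 := hB x ⟨hx, h⟩
      have h2 : (1 + x) ^ b ≤ 2 ^ b := Real.rpow_le_rpow (by linarith) (by linarith) hb
      have h3 : ‖f x‖ ≤ B + C := by linarith
      gcongr
    · have hx0 : 0 < x := by linarith
      have h1 : (1 + x) ^ b ≤ 2 ^ b * x ^ b := by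
        rw [← Real.mul_rpow (by norm_num) hx]
        exact Real.rpow_le_rpow (by linarith) (by linarith) hb
      calc ‖f x‖ * (1 + x) ^ b ≤ C * x ^ (-b) * (2 ^ b * x ^ b) := by
            gcongr
            exact hC x h
        _ = C * 2 ^ b * (x ^ (-b) * x ^ b) := by ring
        _ = C * 2 ^ b := by rw [← Real.rpow_add hx0, neg_add_cancel, Real.rpow_zero, mul_one]
        _ ≤ _ := by gcongr; linarith
  refine ⟨(B + C) * 2 ^ b, fun x => ?_⟩
  have h := key |x| (abs_nonneg x)
  rcases abs_choice x with h' | h' <;> rw [h'] at h ⊢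
  · exact h
  · rwa [hf] at h

theorem exists_bound_Icc {f : ℝ → ℂ} (hf : Continuous f) (a b : ℝ) :
    ∃ B, ∀ x ∈ Set.Icc a b, ‖f x‖ ≤ B :=
  isCompact_Icc.exists_bound_of_continuousOn hf.continuousOn

theorem exists_norm_besselEntire_le (μ : ℂ) {α : ℝ} (hα : 0 < α) :
    ∃ C, 0 ≤ C ∧ ∀ t : ℝ, 1 ≤ t → ‖besselEntire μ (α * t)‖ ≤ C * t ^ (-(μ.re + 1 / 2)) := by
  obtain ⟨C, hC⟩ := exists_besselWave_bound μ hα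
  refine ⟨C, (norm_nonneg _).trans (hC 1 le_rfl).1, fun t ht => ?_⟩
  have h := (hC t ht).1
  have ht0 : 0 < t := by linarith
  rw [besselWave, norm_mul, norm_cpow_ofReal_of_one_le _ ht] at h
  rw [Real.rpow_neg ht0.le, ← div_eq_mul_inv, le_div_iff₀ (by positivity), mul_comm]
  simpa using h

/-- The mean value inequality on the disc of radius ‖z‖ costs one factor ‖z‖, absorbed by half of
the slack σ - τ. -/
theorem ExpTypeLE.primitive {Φ ψ : ℂ → ℂ} {τ : ℝ} (hτ : 0 ≤ τ)
    (hΦ : ∀ z, HasDerivAt Φ (ψ z) z) (h0 : Φ 0 = 0) (hψ : ExpTypeLE ψ τ) : ExpTypeLE Φ τ := by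
  intro σ hσ
  obtain ⟨C, hC⟩ := hψ ((τ + σ) / 2) (by linarith)
  have hC0 := const_nonneg_of_norm_le_exp hC
  obtain ⟨D, hD⟩ := expTypeLE_pow 1 ((σ - τ) / 2) (by linarith)
  refine ⟨C * D, fun z => ?_⟩
  have h := Convex.norm_image_sub_le_of_norm_hasDerivWithin_le (𝕜 := ℂ) (f := Φ) (f' := ψ)
    (s := Metric.closedBall 0 ‖z‖) (x := 0) (y := z) (C := C * Real.exp ((τ + σ) / 2 * ‖z‖))
    (fun x _ => (hΦ x).hasDerivWithinAt) (fun x hx => ?_) (convex_closedBall _ _)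
    (by simp) (by simp)
  · rw [h0, sub_zero, sub_zero] at h
    have h2 := hD z
    simp only [pow_one] at h2
    calc ‖Φ z‖ ≤ C * Real.exp ((τ + σ) / 2 * ‖z‖) * ‖z‖ := h
      _ ≤ C * Real.exp ((τ + σ) / 2 * ‖z‖) * (D * Real.exp ((σ - τ) / 2 * ‖z‖)) := by gcongr
      _ = C * D * (Real.exp ((τ + σ) / 2 * ‖z‖) * Real.exp ((σ - τ) / 2 * ‖z‖)) := by ring
      _ = _ := by rw [← Real.exp_add]; congr 2; ring
  · refine (hC x).trans ?_
    have : ‖x‖ ≤ ‖z‖ := by simpa using hx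
    have : 0 ≤ (τ + σ) / 2 := by linarith
    gcongr

theorem besselEntire_one_ofReal (x : ℝ) : ((besselEntire 1 x).re : ℂ) = besselEntire 1 x := by
  have h : ∀ m : ℕ, besselCoeff 1 m * (-((x : ℂ) / 2) ^ 2) ^ m =
      (((m.factorial * (m + 1).factorial : ℝ)⁻¹ * (-(x / 2) ^ 2) ^ m : ℝ) : ℂ) := by
    intro m
    rw [besselCoeff, show (1 : ℂ) + m + 1 = ((m + 1 : ℕ) : ℂ) + 1 by push_cast; ring,
      Complex.Gamma_nat_eq_factorial]
    push_cast
    rfl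
  unfold besselEntire besselClifford
  rw [tsum_congr h, ← Complex.ofReal_tsum, Complex.ofReal_re]

theorem besselEntire_zero (μ : ℂ) : besselEntire μ 0 = (Complex.Gamma (μ + 1))⁻¹ := by
  unfold besselEntire besselClifford
  rw [tsum_eq_single 0]
  · simp [besselCoeff]
  · intro m hm
    simp [hm]

/-- Φ is the primitive, vanishing at 0, of the square of E_1(δz/2). The square has type δ, is
nonnegative on the real line and is O(x^(-3)). Hence Φ is odd on the reals and tends to ±c, with c
the integral over the positive half-line, and the tail is O(x^(-2)), enough for summability. -/
theorem exists_entire_sign {δ : ℝ} (hδ : 0 < δ) :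
    ∃ (Φ : ℂ → ℂ) (c : ℂ) (D : ℝ), c ≠ 0 ∧ Differentiable ℂ Φ ∧ ExpTypeLE Φ δ ∧
      ∀ x : ℝ, ‖Φ x - c * Real.sign x‖ * (1 + |x|) ^ (2 : ℝ) ≤ D := by
  have hδ2 : 0 < δ / 2 := by positivity
  set ψ : ℂ → ℂ := fun z => besselEntire 1 ((δ / 2 : ℝ) * z) * besselEntire 1 ((δ / 2 : ℝ) * z)
    with hψ
  have hd1 : Differentiable ℂ fun z : ℂ => besselEntire 1 ((δ / 2 : ℝ) * z) :=
    (differentiable_besselEntire 1).comp (differentiable_id.const_mul _)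
  have hψd : Differentiable ℂ ψ := hd1.mul hd1
  have hψe : ExpTypeLE ψ δ := by
    have h := (expTypeLE_besselEntire 1).comp_ofReal_mul hδ2
    exact (h.mul h).mono (by linarith)
  have hψeven : ∀ z, ψ (-z) = ψ z := by
    intro z
    simp only [hψ, mul_neg, besselEntire_neg]
  obtain ⟨Φ, hΦ0, hΦ⟩ := hψd.isExactOn_univ.with_val_at 0 0
  have hΦ' : ∀ z, HasDerivAt Φ (ψ z) z := fun z => hΦ z (Set.mem_univ z)
  have hΦd : Differentiable ℂ Φ := fun z => (hΦ' z).differentiableAt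
  set r : ℝ → ℝ := fun x => (besselEntire 1 ((δ / 2 : ℝ) * x)).re with hr
  have hψr : ∀ x : ℝ, ψ x = ((r x ^ 2 : ℝ) : ℂ) := by
    intro x
    have := besselEntire_one_ofReal (δ / 2 * x)
    rw [Complex.ofReal_mul] at this
    simp only [hψ, hr]
    rw [Complex.ofReal_pow, this, pow_two]
  have hrc : Continuous r := Complex.continuous_re.comp
    (hd1.continuous.comp Complex.continuous_ofReal)
  have hψc : Continuous fun x : ℝ => ψ x := hψd.continuous.comp Complex.continuous_ofReal
  obtain ⟨C, hC0, hC⟩ := exists_norm_besselEntire_le 1 hδ2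
  have hψb : ∀ x : ℝ, 1 ≤ x → ‖ψ x‖ ≤ C ^ 2 * x ^ (-3 : ℝ) := by
    intro x hx
    have h := hC x hx
    rw [Complex.one_re] at h
    rw [hψ, norm_mul]
    refine (mul_le_mul h h (norm_nonneg _) (by positivity)).trans_eq ?_
    rw [mul_mul_mul_comm, ← Real.rpow_add (by linarith), ← pow_two]
    congr 2
    norm_num
  obtain ⟨B, hB⟩ := exists_bound_Icc hψc 0 1
  obtain ⟨E, hE⟩ := decay_of_even (b := 3) (by norm_num)
    (fun x => by rw [Complex.ofReal_neg, hψeven]) hB hψb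
  have hψi : Integrable fun x : ℝ => ψ x := integrable_of_decay hψc (by norm_num) hE
  have hri : Integrable fun x : ℝ => r x ^ 2 := by
    have := hψi.re
    refine this.congr (Eventually.of_forall fun x => ?_)
    simp only [hψr]
    exact Complex.ofReal_re _
  set c : ℂ := ∫ x in Set.Ioi (0 : ℝ), ψ x with hc
  -- The integrand is a real square, continuous, and nonzero at 0 because E_1(0) = 1/Γ(2) = 1.
  have hc0 : c ≠ 0 := by
    have hpos : 0 < ∫ x, r x ^ 2 := by
      refine integral_pos_of_integrable_nonneg_nonzero (x := 0) (hrc.pow 2) hri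
        (fun x => sq_nonneg _) ?_
      simp only [hr, Complex.ofReal_zero, mul_zero, besselEntire_zero]
      rw [show (1 : ℂ) + 1 = ((1 : ℕ) : ℂ) + 1 by norm_num, Complex.Gamma_nat_eq_factorial]
      simp
    have habs : ∫ x, r x ^ 2 = 2 * ∫ x in Set.Ioi (0 : ℝ), r x ^ 2 := by
      rw [← integral_comp_abs (f := fun x => r x ^ 2)]
      refine integral_congr_ae (Eventually.of_forall fun x => ?_)
      rcases abs_choice x with h' | h' <;> dsimp only <;> rw [h']
      simp only [hr, Complex.ofReal_neg, mul_neg, besselEntire_neg]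
    have hcr : c = ((∫ x in Set.Ioi (0 : ℝ), r x ^ 2 : ℝ) : ℂ) := by
      rw [hc, ← integral_complex_ofReal]
      exact integral_congr_ae (Eventually.of_forall fun x => hψr x)
    rw [hcr]
    norm_cast
    intro h
    rw [habs, h] at hpos
    simp at hpos
  have hΦint : ∀ x : ℝ, Φ x = ∫ t in (0 : ℝ)..x, ψ t := by
    intro x
    rw [intervalIntegral.integral_eq_sub_of_hasDerivAt (f := fun t : ℝ => Φ t)
      (fun t _ => (hΦ' t).comp_ofReal) (hψc.intervalIntegrable _ _)]
    simp [hΦ0]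
  have hΦodd : ∀ x : ℝ, Φ ((-x : ℝ) : ℂ) = -Φ x := by
    intro x
    rw [hΦint, hΦint]
    have := intervalIntegral.integral_comp_neg (a := 0) (b := x) (fun t : ℝ => ψ t)
    simp only [Complex.ofReal_neg, hψeven, neg_zero] at this
    rw [this, intervalIntegral.integral_symm]
  have htail : ∀ x : ℝ, 1 ≤ x → ‖Φ x - c * Real.sign x‖ ≤ C ^ 2 * x ^ (-2 : ℝ) := by
    intro x hx
    have hx0 : 0 < x := by linarith
    rw [Real.sign_of_pos hx0, Complex.ofReal_one, mul_one, hΦint, hc,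
      ← intervalIntegral.integral_interval_add_Ioi (b := x) hψi.integrableOn hψi.integrableOn,
      sub_add_cancel_left, norm_neg]
    have h1 : IntegrableOn (fun t : ℝ => C ^ 2 * t ^ (-3 : ℝ)) (Set.Ioi x) :=
      (integrableOn_Ioi_rpow_of_lt (by norm_num) hx0).const_mul _
    refine (norm_integral_le_of_norm_le h1 ((ae_restrict_iff' measurableSet_Ioi).2
      (Eventually.of_forall fun t ht => hψb t (hx.trans (le_of_lt ht))))).trans ?_
    rw [integral_const_mul, integral_Ioi_rpow_of_lt (by norm_num) hx0]
    have h2 : 0 ≤ x ^ (-2 : ℝ) := by positivity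
    refine mul_le_mul_of_nonneg_left ?_ (by positivity)
    rw [show (-3 : ℝ) + 1 = -2 by norm_num]
    linarith
  obtain ⟨B', hB'⟩ := exists_bound_Icc (hΦd.continuous.comp Complex.continuous_ofReal) 0 1
  obtain ⟨D, hD⟩ := decay_of_even (f := fun x : ℝ => Φ x - c * Real.sign x) (b := 2)
    (B := B' + ‖c‖) (by norm_num) (fun x => by
      rw [hΦodd, Real.sign_neg, ← norm_neg]
      congr 1
      push_cast
      ring) (fun x hx => by
      refine (norm_sub_le _ _).trans (add_le_add (hB' x hx) ?_)
      rw [norm_mul, Complex.norm_real]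
      refine mul_le_of_le_one_right (norm_nonneg _) ?_
      rcases Real.sign_apply_eq x with h | h | h <;> simp [h]) htail
  exact ⟨Φ, c, D, hc0, hΦd, hψe.primitive hδ.le hΦ' hΦ0, hD⟩

/-! ### Sums and integrals of functions of exponential type less than `2π` -/

theorem norm_le_of_decay {f : ℝ → ℂ} {b C : ℝ} (hb : 0 ≤ b)
    (hdec : ∀ x : ℝ, ‖f x‖ * (1 + |x|) ^ b ≤ C) (x : ℝ) : ‖f x‖ ≤ C := by
  refine le_trans (le_mul_of_one_le_right (norm_nonneg _) ?_) (hdec x)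
  exact Real.one_le_rpow (by linarith [abs_nonneg x]) hb

theorem tendsto_zero_of_decay {ι : Type*} {l : Filter ι} {f : ℝ → ℂ} {b C : ℝ} (hb : 0 < b)
    (hdec : ∀ x : ℝ, ‖f x‖ * (1 + |x|) ^ b ≤ C) {v : ι → ℝ}
    (hv : Tendsto (fun i => |v i|) l atTop) : Tendsto (fun i => f (v i)) l (𝓝 0) := by
  have h0 : Tendsto (fun i => C * (1 + |v i|) ^ (-b)) l (𝓝 0) := by
    have := ((tendsto_rpow_neg_atTop hb).comp (tendsto_atTop_add_const_left l 1 hv)).const_mul C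
    simpa using this
  refine squeeze_zero_norm (fun i => ?_) h0
  rw [Real.rpow_neg (by positivity), ← div_eq_mul_inv, le_div_iff₀ (by positivity)]
  exact hdec _

theorem tendsto_abs_sub {u : ℕ → ℝ} (hu : Tendsto (fun N => |u N|) atTop atTop) (t : ℝ) :
    Tendsto (fun N => |t - u N|) atTop atTop := by
  refine tendsto_atTop_mono (fun N => ?_) (tendsto_atTop_add_const_right _ (-|t|) hu)
  have := abs_sub_abs_le_abs_sub (u N) t
  rw [abs_sub_comm] at this
  linarith

/-- Translate the sum so that the shift falls on h: each term then tends to 0 because h decays, and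
C|ρ| dominates. Only ρ needs to be summable; h may decay arbitrarily slowly. -/
theorem tendsto_tsum_mul_shift {h ρ : ℝ → ℂ} {b C p D : ℝ} (hb : 0 < b)
    (hh : ∀ x : ℝ, ‖h x‖ * (1 + |x|) ^ b ≤ C) (hp : 1 < p)
    (hρ : ∀ x : ℝ, ‖ρ x‖ * (1 + |x|) ^ p ≤ D) {u : ℕ → ℤ}
    (hu : Tendsto (fun N => |(u N : ℝ)|) atTop atTop) :
    Tendsto (fun N => ∑' m : ℤ, h m * ρ (m + u N)) atTop (𝓝 0) := by
  have hshift : ∀ N, ∑' m : ℤ, h m * ρ (m + u N) = ∑' m : ℤ, h (m - u N) * ρ m := by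
    intro N
    rw [← (Equiv.subRight (u N)).tsum_eq]
    refine tsum_congr fun m => ?_
    simp
  simp only [hshift]
  have hlim := tendsto_tsum_of_dominated_convergence (𝓕 := atTop)
    (f := fun (N : ℕ) (m : ℤ) => h (m - u N) * ρ m) (g := fun _ => 0)
    ((summable_int_of_decay hp hρ).norm.mul_left C) (fun m => ?_)
    (Eventually.of_forall fun N m => ?_)
  · simpa using hlim
  · have := (tendsto_zero_of_decay hb hh (tendsto_abs_sub hu m)).mul_const (ρ m)
    simpa using this
  · rw [norm_mul]
    have := norm_le_of_decay hb.le hh (m - u N)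
    gcongr

theorem tendsto_integral_mul_shift {h ρ : ℝ → ℂ} {b C : ℝ} (hb : 0 < b)
    (hh : ∀ x : ℝ, ‖h x‖ * (1 + |x|) ^ b ≤ C) (hhc : Continuous h) (hρi : Integrable ρ) {u : ℕ → ℝ}
    (hu : Tendsto (fun N => |u N|) atTop atTop) :
    Tendsto (fun N => ∫ t : ℝ, h t * ρ (t + u N)) atTop (𝓝 0) := by
  have hshift : ∀ N, ∫ t : ℝ, h t * ρ (t + u N) = ∫ t : ℝ, h (t - u N) * ρ t := by
    intro N
    rw [← integral_sub_right_eq_self _ (u N)]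
    simp
  simp only [hshift]
  have hlim := tendsto_integral_of_dominated_convergence (μ := volume)
    (F := fun (N : ℕ) (t : ℝ) => h (t - u N) * ρ t) (f := fun _ => 0) (fun t => C * ‖ρ t‖)
    (fun N => (hhc.comp (continuous_sub_right (u N))).aestronglyMeasurable.mul
      hρi.aestronglyMeasurable)
    (hρi.norm.const_mul C) (fun N => Eventually.of_forall fun t => ?_)
    (Eventually.of_forall fun t => ?_)
  · simpa using hlim
  · rw [norm_mul]
    have := norm_le_of_decay hb.le hh (t - u N)
    gcongr
  · have := (tendsto_zero_of_decay hb hh (tendsto_abs_sub hu t)).mul_const (ρ t)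
    simpa using this

theorem measurable_real_sign : Measurable Real.sign := by
  unfold Real.sign
  exact Measurable.ite measurableSet_Iio measurable_const
    (Measurable.ite measurableSet_Ioi measurable_const measurable_const)

/-- Peetre's inequality 1+|x| ≤ (1+|x+u|)(1+|u|). -/
theorem decay_shift {ρ : ℝ → ℂ} {D : ℝ} {p : ℝ} (hp : 0 ≤ p)
    (hρ : ∀ x : ℝ, ‖ρ x‖ * (1 + |x|) ^ p ≤ D) (u x : ℝ) :
    ‖ρ (x + u)‖ * (1 + |x|) ^ p ≤ D * (1 + |u|) ^ p := by
  have h1 : (1 + |x|) ^ p ≤ (1 + |x + u|) ^ p * (1 + |u|) ^ p := by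
    rw [← Real.mul_rpow (by positivity) (by positivity)]
    refine Real.rpow_le_rpow (by positivity) ?_ hp
    have h2 : |x| ≤ |x + u| + |u| := by
      have := abs_sub (x + u) u
      rwa [add_sub_cancel_right] at this
    nlinarith [mul_nonneg (abs_nonneg (x + u)) (abs_nonneg u)]
  calc ‖ρ (x + u)‖ * (1 + |x|) ^ p ≤ ‖ρ (x + u)‖ * ((1 + |x + u|) ^ p * (1 + |u|) ^ p) := by
        gcongr
    _ = ‖ρ (x + u)‖ * (1 + |x + u|) ^ p * (1 + |u|) ^ p := by ring
    _ ≤ _ := by gcongr; exact hρ _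

/-- Twice the indicator function of `[-N, N]`, with half weights at the endpoints. -/
noncomputable def doubleBox (N t : ℝ) : ℝ := Real.sign (t + N) - Real.sign (t - N)

theorem doubleBox_eq_zero {N t : ℝ} (hN : 0 ≤ N) (h : N < |t|) : doubleBox N t = 0 := by
  unfold doubleBox
  rcases lt_abs.1 h with h | h
  · rw [Real.sign_of_pos (by linarith), Real.sign_of_pos (by linarith), sub_self]
  · rw [Real.sign_of_neg (by linarith), Real.sign_of_neg (by linarith), sub_self]

theorem doubleBox_eq_two {N t : ℝ} (h : |t| < N) : doubleBox N t = 2 := by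
  unfold doubleBox
  rw [abs_lt] at h
  rw [Real.sign_of_pos (by linarith), Real.sign_of_neg (by linarith)]
  norm_num

theorem doubleBox_self {N : ℝ} (h : 0 < N) : doubleBox N N = 1 := by
  unfold doubleBox
  rw [Real.sign_of_pos (by linarith), sub_self, Real.sign_zero, sub_zero]

theorem doubleBox_neg (N t : ℝ) : doubleBox N (-t) = doubleBox N t := by
  unfold doubleBox
  rw [show -t + N = -(t - N) by ring, show -t - N = -(t + N) by ring, Real.sign_neg, Real.sign_neg]
  ring

theorem abs_sign_le (t : ℝ) : |Real.sign t| ≤ 1 := by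
  rcases Real.sign_apply_eq t with h | h | h <;> simp [h]

theorem doubleBox_decay {N : ℝ} (hN : 0 ≤ N) {p : ℝ} (hp : 0 ≤ p) (x : ℝ) :
    |doubleBox N x| * (1 + |x|) ^ p ≤ 2 * (1 + N) ^ p := by
  rcases lt_or_ge N |x| with h | h
  · rw [doubleBox_eq_zero hN h, abs_zero, zero_mul]
    positivity
  · have h1 : |doubleBox N x| ≤ 2 := by
      unfold doubleBox
      refine (abs_sub _ _).trans ?_
      linarith [abs_sign_le (x + N), abs_sign_le (x - N)]
    gcongr

theorem integral_mul_doubleBox {h : ℝ → ℂ} (heven : ∀ x, h (-x) = h x) (hc : Continuous h)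
    {N : ℝ} (hN : 0 ≤ N) :
    ∫ t : ℝ, h t * doubleBox N t = 4 * ∫ t in (0 : ℝ)..N, h t := by
  have h1 : ∫ t : ℝ, h t * doubleBox N t = ∫ t : ℝ, (Set.Ioc (-N) N).indicator (fun t => 2 * h t) t := by
    refine integral_congr_ae ?_
    have : ∀ᵐ t : ℝ, t ∉ ({-N, N} : Set ℝ) :=
      measure_eq_zero_iff_ae_notMem.1 ((Set.toFinite _).measure_zero volume)
    filter_upwards [this] with t ht
    simp only [Set.mem_insert_iff, Set.mem_singleton_iff, not_or] at ht
    by_cases hm : t ∈ Set.Ioc (-N) N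
    · rw [Set.indicator_of_mem hm, doubleBox_eq_two (abs_lt.2 ⟨hm.1, lt_of_le_of_ne hm.2 ht.2⟩)]
      push_cast
      ring
    · rw [Set.indicator_of_notMem hm, doubleBox_eq_zero hN]
      · simp
      · by_contra hle
        rw [not_lt, abs_le] at hle
        exact hm ⟨lt_of_le_of_ne hle.1 (Ne.symm ht.1), hle.2⟩
  rw [h1, integral_indicator measurableSet_Ioc, integral_const_mul,
    ← intervalIntegral.integral_of_le (by linarith),
    ← intervalIntegral.integral_add_adjacent_intervals (b := 0) (hc.intervalIntegrable _ _)
      (hc.intervalIntegrable _ _)]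
  have h2 := intervalIntegral.integral_comp_neg (a := 0) (b := N) h
  simp only [heven, neg_zero] at h2
  rw [← h2]
  ring

/-- The box has weight 2 inside and 1 at ±N, so folding m with -m gives 4h(m) for 0 < m < N, 2h(0)
at the centre and 2h(N) from the two endpoints. -/
theorem hasSum_mul_doubleBox {h : ℝ → ℂ} (heven : ∀ x, h (-x) = h x) {N : ℕ} (hN : 1 ≤ N) :
    HasSum (fun m : ℤ => h m * doubleBox N m)
      (4 * (∑ m ∈ Finset.range N, h m - h 0 / 2) + 2 * h N) := by
  have hN0 : (0 : ℝ) ≤ N := by positivity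
  set F : ℤ → ℂ := fun m => h m * doubleBox N m with hF
  have hsum : Summable F := by
    refine summable_of_ne_finset_zero (s := Finset.Icc (-(N : ℤ)) N) fun m hm => ?_
    rw [hF]
    simp only
    rw [doubleBox_eq_zero hN0, Complex.ofReal_zero, mul_zero]
    rw [Finset.mem_Icc, ← abs_le, not_le] at hm
    exact_mod_cast hm
  have hF0 : F 0 = 2 * h 0 := by
    simp only [hF]
    rw [doubleBox_eq_two (by simpa using (Nat.succ_le_iff.1 hN))]
    push_cast
    ring
  -- Pairing n with -n over ℕ counts n = 0 twice, which is why F 0 is subtracted at the end.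
  have h1 := hsum.hasSum.nat_add_neg
  have h2 : ∀ n : ℕ, F n + F (-n) = 2 * F n := by
    intro n
    simp only [hF, Int.cast_neg, heven, doubleBox_neg]
    ring
  simp only [h2] at h1
  have h3 : HasSum (fun n : ℕ => 2 * F n) (∑ n ∈ Finset.range (N + 1), 2 * F n) := by
    refine hasSum_sum_of_ne_finset_zero fun n hn => ?_
    simp only [hF]
    rw [doubleBox_eq_zero hN0, Complex.ofReal_zero, mul_zero, mul_zero]
    rw [Finset.mem_range, not_lt] at hn
    simp only [Int.cast_natCast, Nat.abs_cast]
    exact_mod_cast hn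
  have h4 : ∑ n ∈ Finset.range (N + 1), 2 * F n =
      4 * ∑ m ∈ Finset.range N, h m + 2 * h N := by
    rw [Finset.sum_range_succ, Finset.mul_sum]
    congr 1
    · refine Finset.sum_congr rfl fun n hn => ?_
      simp only [hF, Int.cast_natCast]
      rw [doubleBox_eq_two (by simpa using hn)]
      push_cast
      ring
    · simp only [hF, Int.cast_natCast]
      rw [doubleBox_self (by exact_mod_cast hN)]
      push_cast
      ring
  have h5 := h1.unique h3
  rw [h4, hF0] at h5
  convert hsum.hasSum using 1
  linear_combination -h5

/-- For an even entire function of exponential type less than `2π` that decays on the real line,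
the trapezoidal sums and the integrals have vanishing difference. -/
theorem tendsto_sum_sub_integral {h : ℂ → ℂ} {τ b C : ℝ} (hd : Differentiable ℂ h)
    (heven : ∀ z, h (-z) = h z) (hτ : τ < 2 * Real.pi) (hexp : ExpTypeLE h τ) (hb : 0 < b)
    (hdec : ∀ x : ℝ, ‖h x‖ * (1 + |x|) ^ b ≤ C) :
    Tendsto (fun N : ℕ => (∑ m ∈ Finset.range N, h ((m : ℝ) : ℂ) - h 0 / 2) -
      ∫ t in (0 : ℝ)..N, h t) atTop (𝓝 0) := by
  -- This δ uses up the whole spare type: h times shifts of Φ has type at most 2π, the limit for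
  -- exact summation.
  obtain ⟨Φ, c, D, hc0, hΦd, hΦe, hΦ⟩ := exists_entire_sign (δ := 2 * Real.pi - τ) (by linarith)
  set ρ : ℝ → ℂ := fun x => Φ x - c * Real.sign x with hρ
  have hC0 : 0 ≤ C := le_trans (by positivity) (hdec 0)
  have hhc : Continuous fun x : ℝ => h x := hd.continuous.comp Complex.continuous_ofReal
  have heven' : ∀ x : ℝ, h ((-x : ℝ) : ℂ) = h x := fun x => by
    rw [Complex.ofReal_neg, heven]
  have hρi : Integrable ρ := by
    have hi := (integrable_one_add_norm (E := ℝ) (μ := volume) (r := 2) (by simp)).const_mul D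
    refine hi.mono' ?_ (Eventually.of_forall fun x => ?_)
    · refine AEStronglyMeasurable.sub ?_ ?_
      · exact (hΦd.continuous.comp Complex.continuous_ofReal).aestronglyMeasurable
      · exact ((Complex.measurable_ofReal.comp measurable_real_sign).const_mul c).aestronglyMeasurable
    · rw [Real.rpow_neg (by positivity), ← div_eq_mul_inv, le_div_iff₀ (by positivity)]
      exact hΦ x
  have hbound : ∀ x, ‖h ((x : ℝ) : ℂ)‖ ≤ C := norm_le_of_decay hb.le hdec
  set E₁ : ℕ → ℂ := fun N => ∑' m : ℤ, h ((m : ℝ) : ℂ) * ρ (m + ((N : ℤ) : ℝ)) with hE₁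
  set E₂ : ℕ → ℂ := fun N => ∑' m : ℤ, h ((m : ℝ) : ℂ) * ρ (m + ((-N : ℤ) : ℝ)) with hE₂
  set E₃ : ℕ → ℂ := fun N => ∫ t : ℝ, h t * ρ (t + N) with hE₃
  set E₄ : ℕ → ℂ := fun N => ∫ t : ℝ, h t * ρ (t + -N) with hE₄
  have habs : Tendsto (fun N : ℕ => |(N : ℝ)|) atTop atTop := by
    simpa using tendsto_natCast_atTop_atTop (R := ℝ)
  have t₁ : Tendsto E₁ atTop (𝓝 0) := tendsto_tsum_mul_shift (h := fun x : ℝ => h x) hb hdec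
    one_lt_two hΦ (u := fun N => (N : ℤ)) (by simpa using habs)
  have t₂ : Tendsto E₂ atTop (𝓝 0) := tendsto_tsum_mul_shift (h := fun x : ℝ => h x) hb hdec
    one_lt_two hΦ (u := fun N => (-N : ℤ)) (by simpa using habs)
  have t₃ : Tendsto E₃ atTop (𝓝 0) := tendsto_integral_mul_shift (h := fun x : ℝ => h x) hb hdec
    hhc hρi (u := fun N => (N : ℝ)) habs
  have t₄ : Tendsto E₄ atTop (𝓝 0) := tendsto_integral_mul_shift (h := fun x : ℝ => h x) hb hdec
    hhc hρi (u := fun N => -(N : ℝ)) (by simpa using habs)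
  have hshiftdec : ∀ u x : ℝ, ‖h x * ρ (x + u)‖ * (1 + |x|) ^ (2 : ℝ) ≤
      C * (D * (1 + |u|) ^ (2 : ℝ)) := by
    intro u x
    rw [norm_mul, mul_assoc]
    exact mul_le_mul (hbound x) (decay_shift (by norm_num) hΦ u x) (by positivity) hC0
  have hboxdec : ∀ (N : ℕ) (x : ℝ), ‖h x * doubleBox N x‖ * (1 + |x|) ^ (2 : ℝ) ≤
      C * (2 * (1 + N) ^ (2 : ℝ)) := by
    intro N x
    rw [norm_mul, Complex.norm_real, mul_assoc]
    exact mul_le_mul (hbound x) (doubleBox_decay (by positivity) (by norm_num) x)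
      (by positivity) hC0
  have hsplit : ∀ (N : ℕ) (x : ℝ), h x * (Φ (x + N) - Φ (x + -N)) =
      c * (h x * doubleBox N x) + h x * ρ (x + N) - h x * ρ (x + -N) := by
    intro N x
    simp only [hρ, doubleBox]
    push_cast
    rw [sub_eq_add_neg x]
    ring
  -- Exact Poisson summation for h(z)(Φ(z+N) - Φ(z-N)), split by Φ = c·sign + ρ. The sign part is
  -- the box and yields the trapezoidal sum and the integral; the four terms with ρ and the endpoint
  -- value h(N) are the errors.
  have key : ∀ N : ℕ, 1 ≤ N → c * (4 * ((∑ m ∈ Finset.range N, h ((m : ℝ) : ℂ) - h 0 / 2) -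
      ∫ t in (0 : ℝ)..N, h t)) = E₃ N - E₄ N - E₁ N + E₂ N - 2 * c * h ((N : ℝ) : ℂ) := by
    intro N hN
    -- The decay constant grows with N, harmlessly: the identity is used for each N separately. The
    -- exponent 2 comes from ρ and the compactly supported box, with h merely bounded.
    have hP := tsum_int_eq_integral (f := fun z => h z * (Φ (z + N) - Φ (z + -N))) (b := 2)
      (C := ‖c‖ * (C * (2 * (1 + N) ^ (2 : ℝ))) + C * (D * (1 + |(N : ℝ)|) ^ (2 : ℝ)) +
        C * (D * (1 + |-(N : ℝ)|) ^ (2 : ℝ)))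
      (hd.mul ((hΦd.comp (differentiable_id.add_const _)).sub
        (hΦd.comp (differentiable_id.add_const _)))) one_lt_two ?_ ?_
    · have hs₁ : Summable fun m : ℤ => h ((m : ℝ) : ℂ) * ρ (m + ((N : ℤ) : ℝ)) :=
        summable_int_of_decay (f := fun x : ℝ => h x * ρ (x + ((N : ℤ) : ℝ))) one_lt_two
          (hshiftdec ((N : ℤ) : ℝ))
      have hs₂ : Summable fun m : ℤ => h ((m : ℝ) : ℂ) * ρ (m + ((-N : ℤ) : ℝ)) :=
        summable_int_of_decay (f := fun x : ℝ => h x * ρ (x + ((-N : ℤ) : ℝ))) one_lt_two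
          (hshiftdec ((-N : ℤ) : ℝ))
      have hs₀ := (hasSum_mul_doubleBox (h := fun x : ℝ => h x) heven' hN).mul_left c
      have hL := ((hs₀.add hs₁.hasSum).sub hs₂.hasSum).tsum_eq
      have hi : ∀ u : ℝ, Integrable fun x : ℝ => h x * ρ (x + u) := fun u =>
        (hρi.comp_add_right u).bdd_mul hhc.aestronglyMeasurable (Eventually.of_forall hbound)
      have hi₀ : Integrable fun x : ℝ => c * (h x * doubleBox N x) := by
        have hint := (integrable_one_add_norm (E := ℝ) (μ := volume) (r := 2) (by simp)).const_mul
          (C * (2 * (1 + N) ^ (2 : ℝ)))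
        refine (hint.mono' ?_ (Eventually.of_forall fun x => ?_)).const_mul c
        · refine hhc.aestronglyMeasurable.mul ?_
          refine (Complex.measurable_ofReal.comp ?_).aestronglyMeasurable
          exact (measurable_real_sign.comp (measurable_add_const _)).sub
            (measurable_real_sign.comp (measurable_sub_const _))
        · rw [Real.rpow_neg (by positivity), ← div_eq_mul_inv, le_div_iff₀ (by positivity)]
          exact hboxdec N x
      have hR : ∫ x : ℝ, h x * (Φ (x + N) - Φ (x + -N)) =
          c * (4 * ∫ t in (0 : ℝ)..N, h t) + E₃ N - E₄ N := by
        have hi₁ : Integrable fun x : ℝ => c * (h x * doubleBox N x) + h x * ρ (x + N) :=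
          hi₀.add (hi N)
        simp only [hsplit]
        rw [integral_sub hi₁ (hi (-N)), integral_add hi₀ (hi N), integral_const_mul,
          integral_mul_doubleBox heven' hhc (by positivity)]
      have hT : ∑' m : ℤ, h m * (Φ (m + N) - Φ (m + -N)) =
          ∑' m : ℤ, (c * (h ((m : ℝ) : ℂ) * doubleBox N m) +
            h ((m : ℝ) : ℂ) * ρ (m + ((N : ℤ) : ℝ)) - h ((m : ℝ) : ℂ) * ρ (m + ((-N : ℤ) : ℝ))) := by
        refine tsum_congr fun m => ?_
        have := hsplit N m
        push_cast at this ⊢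
        exact this
      rw [hR, hT, hL] at hP
      simp only [Complex.ofReal_zero] at hP
      linear_combination hP
    · have hδ : 0 ≤ 2 * Real.pi - τ := by linarith
      have := hexp.mul ((hΦe.comp_add_const hδ N).sub (hΦe.comp_add_const hδ (-N)))
      exact this.mono (by linarith)
    · intro x
      rw [hsplit]
      refine le_trans (mul_le_mul_of_nonneg_right ((norm_sub_le _ _).trans
        (add_le_add_left (norm_add_le _ _) _)) (by positivity)) ?_
      rw [add_mul, add_mul, norm_mul c, mul_assoc]
      refine add_le_add (add_le_add ?_ (hshiftdec _ _)) (hshiftdec _ _)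
      exact mul_le_mul_of_nonneg_left (hboxdec N x) (norm_nonneg _)
  have hN0 : Tendsto (fun N : ℕ => h ((N : ℝ) : ℂ)) atTop (𝓝 0) :=
    tendsto_zero_of_decay (f := fun x : ℝ => h x) hb hdec habs
  have hlim := ((((t₃.sub t₄).sub t₁).add t₂).sub (hN0.const_mul (2 * c))).const_mul (4 * c)⁻¹
  simp only [sub_zero, add_zero, mul_zero] at hlim
  refine hlim.congr' ?_
  filter_upwards [eventually_ge_atTop 1] with N hN
  rw [← key N hN]
  field_simp

/-! ### Products of two Bessel functions -/

/-- The even entire function `z ^ (2k)` times the entire parts of `J_μ(αz)` and `J_ν(βz)`. -/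
noncomputable def besselProduct (μ ν : ℂ) (α β : ℝ) (k : ℕ) (z : ℂ) : ℂ :=
  z ^ (2 * k) * (besselEntire μ (α * z) * besselEntire ν (β * z))

theorem besselProduct_neg (μ ν : ℂ) (α β : ℝ) (k : ℕ) (z : ℂ) :
    besselProduct μ ν α β k (-z) = besselProduct μ ν α β k z := by
  unfold besselProduct
  rw [mul_neg, mul_neg, besselEntire_neg, besselEntire_neg, (even_two_mul k).neg_pow]

theorem differentiable_besselProduct (μ ν : ℂ) (α β : ℝ) (k : ℕ) :
    Differentiable ℂ (besselProduct μ ν α β k) :=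
  (differentiable_id.pow _).mul
    (((differentiable_besselEntire μ).comp (differentiable_id.const_mul _)).mul
      ((differentiable_besselEntire ν).comp (differentiable_id.const_mul _)))

theorem expTypeLE_besselProduct (μ ν : ℂ) {α β : ℝ} (hα : 0 < α) (hβ : 0 < β) (k : ℕ) :
    ExpTypeLE (besselProduct μ ν α β k) (α + β) := by
  have h := (expTypeLE_pow (2 * k)).mul
    (((expTypeLE_besselEntire μ).comp_ofReal_mul hα).mul
      ((expTypeLE_besselEntire ν).comp_ofReal_mul hβ))
  exact h.mono (by linarith)

/-- Each Bessel factor contributes t^(-1/2) beyond its normalising power, which accounts for the +1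
in the exponent. -/
theorem exists_besselProduct_decay (μ ν : ℂ) {α β : ℝ} (hα : 0 < α) (hβ : 0 < β) (k : ℕ)
    (hre : 0 ≤ (μ + ν).re + 1 - 2 * k) :
    ∃ C, ∀ x : ℝ, ‖besselProduct μ ν α β k x‖ * (1 + |x|) ^ ((μ + ν).re + 1 - 2 * k) ≤ C := by
  obtain ⟨C, hC0, hC⟩ := exists_norm_besselEntire_le μ hα
  obtain ⟨D, hD0, hD⟩ := exists_norm_besselEntire_le ν hβ
  obtain ⟨B, hB⟩ := exists_bound_Icc
    ((differentiable_besselProduct μ ν α β k).continuous.comp Complex.continuous_ofReal) 0 1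
  refine decay_of_even (C := C * D) hre (fun x => by rw [Complex.ofReal_neg, besselProduct_neg])
    hB fun x hx => ?_
  have hx0 : 0 < x := by linarith
  rw [besselProduct, norm_mul, norm_mul, norm_pow, Complex.norm_real, Real.norm_of_nonneg hx0.le]
  calc x ^ (2 * k) * (‖besselEntire μ (α * x)‖ * ‖besselEntire ν (β * x)‖)
      ≤ x ^ (2 * k) * (C * x ^ (-(μ.re + 1 / 2)) * (D * x ^ (-(ν.re + 1 / 2)))) := by
        gcongr
        exacts [hC x hx, hD x hx]
    _ = C * D * (x ^ ((2 * k : ℕ) : ℝ) * x ^ (-(μ.re + 1 / 2)) * x ^ (-(ν.re + 1 / 2))) := by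
        rw [Real.rpow_natCast]; ring
    _ = _ := by
        rw [← Real.rpow_add hx0, ← Real.rpow_add hx0, Complex.add_re]
        congr 2
        push_cast
        ring

theorem tendsto_integral_zero_of_even {h : ℝ → ℂ} (heven : ∀ x, h (-x) = h x)
    (hc : Continuous h) (hi : Integrable h) :
    Tendsto (fun T : ℝ => ∫ t in (0 : ℝ)..T, h t) atTop (𝓝 ((∫ t, h t) / 2)) := by
  have h1 := (intervalIntegral_tendsto_integral hi tendsto_neg_atTop_atBot tendsto_id).div_const 2
  refine h1.congr fun T => ?_
  rw [id, ← intervalIntegral.integral_add_adjacent_intervals (b := 0) (hc.intervalIntegrable _ _)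
      (hc.intervalIntegrable _ _)]
  have h2 := intervalIntegral.integral_comp_neg (a := 0) (b := T) h
  simp only [heven, neg_zero] at h2
  rw [← h2]
  ring

theorem tendsto_sum_range_of_even {h : ℝ → ℂ} (heven : ∀ x, h (-x) = h x)
    (hs : Summable fun n : ℤ => h n) :
    Tendsto (fun N : ℕ => ∑ m ∈ Finset.range N, h m - h 0 / 2) atTop
      (𝓝 ((∑' n : ℤ, h n) / 2)) := by
  have h1 := hs.hasSum.nat_add_neg.tendsto_sum_nat
  have h2 := ((h1.sub_const (h 0)).div_const 2)
  simp only [Int.cast_zero, add_sub_cancel_right] at h2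
  refine h2.congr fun N => ?_
  simp only [Int.cast_neg, Int.cast_natCast, heven, ← two_mul, ← Finset.mul_sum]
  ring

theorem besselProduct_eq_cpow_mul (μ ν : ℂ) (α β : ℝ) (k : ℕ) {t : ℝ} (ht : 0 < t) :
    besselProduct μ ν α β k t =
      (t : ℂ) ^ (-(μ + ν + 1 - 2 * k)) * (besselWave μ α t * besselWave ν β t) := by
  have ht' : (t : ℂ) ≠ 0 := by exact_mod_cast ht.ne'
  unfold besselProduct besselWave
  have h : (t : ℂ) ^ (2 * k) =
      (t : ℂ) ^ (-(μ + ν + 1 - 2 * k)) * ((t : ℂ) ^ (μ + 1 / 2) * (t : ℂ) ^ (ν + 1 / 2)) := by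
    rw [← Complex.cpow_add _ _ ht', ← Complex.cpow_add _ _ ht', ← Complex.cpow_natCast]
    congr 1
    push_cast
    ring
  rw [h]
  ring

theorem exists_tendsto_integral_besselProduct (μ ν : ℂ) {α β : ℝ} (hα : 0 < α) (hβ : 0 < β)
    (hαβ : α ≠ β) (k : ℕ) (hre : 0 < (μ + ν + 1 - 2 * k).re) :
    ∃ S, Tendsto (fun T : ℝ => ∫ t in (0 : ℝ)..T, besselProduct μ ν α β k t) atTop (𝓝 S) := by
  obtain ⟨L, hL⟩ := exists_tendsto_integral_of_bessel_ode hα hβ hαβ hre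
    (fun t ht => hasDerivAt_besselWave μ α (zero_lt_one.trans_le ht))
    (fun t ht => hasDerivAt_besselWaveDeriv μ α (zero_lt_one.trans_le ht))
    (fun t ht => hasDerivAt_besselWave ν β (zero_lt_one.trans_le ht))
    (fun t ht => hasDerivAt_besselWaveDeriv ν β (zero_lt_one.trans_le ht))
  have hc : Continuous fun t : ℝ => besselProduct μ ν α β k t :=
    (differentiable_besselProduct μ ν α β k).continuous.comp Complex.continuous_ofReal
  refine ⟨(∫ t in (0 : ℝ)..1, besselProduct μ ν α β k t) + L, (hL.const_add _).congr' ?_⟩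
  filter_upwards [eventually_ge_atTop 1] with T hT
  rw [← intervalIntegral.integral_add_adjacent_intervals (a := 0) (b := 1) (c := T)
    (hc.intervalIntegrable _ _) (hc.intervalIntegrable _ _)]
  congr 1
  have hEq : Set.EqOn (fun t : ℝ => (t : ℂ) ^ (-(μ + ν + 1 - 2 * k)) *
      (besselWave μ α t * besselWave ν β t)) (fun t : ℝ => besselProduct μ ν α β k t)
      (Set.uIcc 1 T) := by
    intro t ht
    rw [Set.uIcc_of_le hT] at ht
    exact (besselProduct_eq_cpow_mul μ ν α β k (zero_lt_one.trans_le ht.1)).symm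
  exact intervalIntegral.integral_congr hEq

/-- Above the threshold Re(μ+ν) = 2k the product is absolutely integrable and Poisson summation
applies directly, even at type 2π. At or below it, the extra hypothesis excludes type 2π and equal
frequencies, which is exactly what the cutoff and the Wronskian arguments need. -/
theorem exists_sum_eq_integral_besselProduct (μ ν : ℂ) {α β : ℝ} (hα : 0 < α) (hβ : 0 < β)
    (k : ℕ) (hαβ : α + β ≤ 2 * Real.pi) (hre : 2 * (k : ℝ) - 1 < (μ + ν).re)
    (hre' : α + β = 2 * Real.pi ∨ α = β → 2 * (k : ℝ) < (μ + ν).re) :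
    ∃ S, Tendsto (fun T : ℝ => ∫ t in (0 : ℝ)..T, besselProduct μ ν α β k t) atTop (𝓝 S) ∧
      Tendsto (fun N : ℕ => ∑ m ∈ Finset.range N, besselProduct μ ν α β k ((m : ℝ) : ℂ) -
        besselProduct μ ν α β k 0 / 2) atTop (𝓝 S) := by
  set h := besselProduct μ ν α β k with hh
  have hd : Differentiable ℂ h := differentiable_besselProduct μ ν α β k
  have heven : ∀ z, h (-z) = h z := besselProduct_neg μ ν α β k
  have heven' : ∀ x : ℝ, h ((-x : ℝ) : ℂ) = h x := fun x => by rw [Complex.ofReal_neg, heven]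
  have hc : Continuous fun t : ℝ => h t := hd.continuous.comp Complex.continuous_ofReal
  have hexp : ExpTypeLE h (α + β) := expTypeLE_besselProduct μ ν hα hβ k
  obtain ⟨C, hC⟩ := exists_besselProduct_decay μ ν hα hβ k (by linarith)
  by_cases hcase : 2 * (k : ℝ) < (μ + ν).re
  · have hb : 1 < (μ + ν).re + 1 - 2 * k := by linarith
    refine ⟨(∫ t : ℝ, h t) / 2,
      tendsto_integral_zero_of_even heven' hc (integrable_of_decay hc hb hC), ?_⟩
    have hP := tsum_int_eq_integral hd hb (hexp.mono hαβ) hC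
    have := tendsto_sum_range_of_even (h := fun x : ℝ => h x) heven' (summable_int_of_decay hb hC)
    simp only [Complex.ofReal_zero, Complex.ofReal_intCast] at this
    rwa [hP] at this
  · have hne : ¬(α + β = 2 * Real.pi ∨ α = β) := fun h => hcase (hre' h)
    rw [not_or] at hne
    obtain ⟨S, hS⟩ := exists_tendsto_integral_besselProduct μ ν hα hβ hne.2 k (by
      simp only [Complex.add_re, Complex.sub_re, Complex.one_re, Complex.mul_re, Complex.re_ofNat,
        Complex.natCast_re, Complex.im_ofNat, Complex.natCast_im] at hre ⊢
      linarith)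
    refine ⟨S, hS, ?_⟩
    have hdiff := tendsto_sum_sub_integral hd heven (lt_of_le_of_ne hαβ hne.1) hexp
      (by linarith : 0 < (μ + ν).re + 1 - 2 * k) hC
    have := hdiff.add (hS.comp tendsto_natCast_atTop_atTop)
    rw [zero_add] at this
    refine this.congr fun N => ?_
    simp only [Function.comp]
    ring

/-! ### From the entire product back to the Bessel quotient. -/

theorem besselEntire_abs_mul (μ : ℂ) (a t : ℝ) :
    besselEntire μ ((a * t : ℝ) : ℂ) = besselEntire μ ((|a| : ℝ) * t) := by
  rcases abs_choice a with h | h <;> rw [h]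
  · push_cast; rfl
  · push_cast; rw [neg_mul, besselEntire_neg]

/-- A positive factor does not change the argument, so it leaves the principal power even when a <
0. The signs of a and b therefore affect only the constant in front of the even entire product. -/
theorem half_mul_cpow (μ : ℂ) {a t : ℝ} (ha : a ≠ 0) (ht : 0 < t) :
    (((a * t : ℝ) : ℂ) / 2) ^ μ = (t : ℂ) ^ μ * ((a : ℂ) / 2) ^ μ := by
  have ha' : (a : ℂ) / 2 ≠ 0 := div_ne_zero (by exact_mod_cast ha) two_ne_zero
  have ht' : (t : ℂ) ≠ 0 := by exact_mod_cast ht.ne'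
  rw [show ((a * t : ℝ) : ℂ) / 2 = t * (a / 2) by push_cast; ring,
    Complex.cpow_def_of_ne_zero (mul_ne_zero ht' ha'), Complex.cpow_def_of_ne_zero ht',
    Complex.cpow_def_of_ne_zero ha', Complex.log_ofReal_mul ht ha', ← Complex.exp_add,
    Complex.ofReal_log ht.le, add_mul]

theorem besselQuotient_eq (μ ν : ℂ) {a b : ℝ} (ha : a ≠ 0) (hb : b ≠ 0) (k : ℕ) {t : ℝ}
    (ht : 0 < t) :
    besselQuotient μ ν a b k t =
      ((a : ℂ) / 2) ^ μ * ((b : ℂ) / 2) ^ ν * besselProduct μ ν |a| |b| k t := by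
  have ht' : (t : ℂ) ≠ 0 := by exact_mod_cast ht.ne'
  have h2k : (t : ℂ) ^ (2 * (k : ℂ)) = (t : ℂ) ^ (2 * k) := by
    rw [← Complex.cpow_natCast]; push_cast; rfl
  unfold besselQuotient besselProduct
  rw [besselJ_eq, besselJ_eq, half_mul_cpow μ ha ht, half_mul_cpow ν hb ht, besselEntire_abs_mul,
    besselEntire_abs_mul, Complex.cpow_sub _ _ ht', Complex.cpow_add _ _ ht', h2k]
  have h1 : (t : ℂ) ^ μ ≠ 0 := by simp [Complex.cpow_eq_zero_iff, ht']
  have h2 : (t : ℂ) ^ ν ≠ 0 := by simp [Complex.cpow_eq_zero_iff, ht']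
  field_simp

theorem mainTheorem2 (μ ν : ℂ) (a b : ℝ) (k : ℕ)
    (ha : a ≠ 0) (hb : b ≠ 0)
    (hab : |a| + |b| ≤ 2 * Real.pi)
    (hμ : ∀ n : ℕ, μ ≠ -((n : ℂ) + 1))
    (hν : ∀ n : ℕ, ν ≠ -((n : ℂ) + 1))
    (hre : 2 * (k : ℝ) - 1 < (μ + ν).re)
    (hre' : |a| + |b| = 2 * Real.pi ∨ a = b ∨ a = -b → 2 * (k : ℝ) < (μ + ν).re) :
    ∃ f₀ S : ℂ,
      -- the value at `0` is the limit from the right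
      Tendsto (besselQuotient μ ν a b k) (𝓝[>] 0) (𝓝 f₀) ∧
      -- the improper integral over `(0, ∞)` converges, with value `S`
      (∀ T : ℝ, 0 < T → IntervalIntegrable (besselQuotient μ ν a b k) volume 0 T) ∧
      Tendsto (fun T : ℝ => ∫ t in (0 : ℝ)..T, besselQuotient μ ν a b k t) atTop (𝓝 S) ∧
      -- the series converges, with the same value `S`
      Tendsto (fun M : ℕ => ∑ m ∈ Finset.range M,
          epsilonWeight m * (if m = 0 then f₀ else besselQuotient μ ν a b k (m : ℝ)))
        atTop (𝓝 S) := by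
  set K : ℂ := ((a : ℂ) / 2) ^ μ * ((b : ℂ) / 2) ^ ν with hK
  set h := besselProduct μ ν |a| |b| k with hh
  have hc : Continuous fun t : ℝ => K * h t :=
    ((differentiable_besselProduct μ ν |a| |b| k).continuous.comp
      Complex.continuous_ofReal).const_mul K
  have hF : ∀ t : ℝ, 0 < t → besselQuotient μ ν a b k t = K * h t := fun t ht =>
    besselQuotient_eq μ ν ha hb k ht
  obtain ⟨S, hS, hS'⟩ := exists_sum_eq_integral_besselProduct μ ν (abs_pos.2 ha) (abs_pos.2 hb) k
    hab hre (fun h => hre' (h.imp_right abs_eq_abs.1))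
  have hcongr : ∀ T : ℝ, 0 < T → Set.EqOn (fun t : ℝ => K * h t) (besselQuotient μ ν a b k)
      (Set.uIoc 0 T) := by
    intro T hT t ht
    rw [Set.uIoc_of_le hT.le] at ht
    exact (hF t ht.1).symm
  -- The limit at 0 is the value there of the continuous extension K·h.
  refine ⟨K * h 0, K * S, ?_, ?_, ?_, ?_⟩
  · have h0 : Tendsto (fun t : ℝ => K * h t) (𝓝[>] 0) (𝓝 (K * h ((0 : ℝ) : ℂ))) :=
      (hc.tendsto 0).mono_left nhdsWithin_le_nhds
    rw [Complex.ofReal_zero] at h0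
    refine h0.congr' ?_
    filter_upwards [self_mem_nhdsWithin] with t ht
    exact (hF t ht).symm
  · intro T hT
    exact (hc.intervalIntegrable 0 T).congr (hcongr T hT)
  · refine (hS.const_mul K).congr' ?_
    filter_upwards [eventually_gt_atTop 0] with T hT
    rw [← intervalIntegral.integral_const_mul]
    exact intervalIntegral.integral_congr_ae
      (Eventually.of_forall fun t ht => hcongr T hT ht)
  · refine (hS'.const_mul K).congr' ?_
    -- With M ≥ 1 the index 0 is in the range, so the weight 1/2 accounts for the subtracted
    -- K·h(0)/2.
    filter_upwards [eventually_ge_atTop 1] with M hM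
    have hterm : ∀ m : ℕ, epsilonWeight m *
        (if m = 0 then K * h 0 else besselQuotient μ ν a b k (m : ℝ)) =
        K * h ((m : ℝ) : ℂ) - if m = 0 then K * h 0 / 2 else 0 := by
      intro m
      by_cases hm : m = 0
      · subst hm
        simp only [epsilonWeight, if_true, Nat.cast_zero, Complex.ofReal_zero]
        ring
      · rw [hF m (by exact_mod_cast Nat.pos_of_ne_zero hm)]
        simp [epsilonWeight, hm]
    simp only [hterm]
    rw [Finset.sum_sub_distrib, Finset.sum_ite_eq', if_pos (Finset.mem_range.2 (by omega)),
      ← Finset.mul_sum]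
    ring
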